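/- **Theorem.** Let $K$ be a field and $X$ a set. Let $\mathrm{DerPerm}\langle X\rangle$ be the free algebra generated by $X$ in the class of perm algebras over $K$ (associative algebras with $a(bc)=b(ac)$) with a derivation $d$. Write $x^{(k)}=d^k(x)$; a monomial is a product $a=x_{i_1}^{(k_1)}\cdots x_{i_{n-1}}^{(k_{n-1})}x_{i_n}^{(k_n)}$ with $n\ge 1$, and its weight is $\mathrm{wt}(a)=\sum_{j=1}^n (k_j-1)$. Put $u\succ v=d(u)v$ and $u\prec v=u\,d(v)$, and let $\mathrm{DerPerm}_\succ\langle X\rangle$ and $\mathrm{DerPerm}_\prec\langle X\rangle$ be the subalgebras of $\mathrm{DerPerm}\langle X\rangle$ generated by $X$ under $\succ$ and under $\prec$, respectively. A Novikov dialgebra is a vector space with bilinear operations $\vdash,\dashv$ satisfying $(a\dashv b)\vdash c=(a\vdash b)\vdash c$, $\ a\dashv(b\vdash c)=a\dashv(b\dashv c)$, $(a\vdash b)\vdash c-a\vdash(b\vdash c)=(b\vdash a)\vdash c-b\vdash(a\vdash c)$, $\ (a\dashv b)\dashv c=(a\dashv c)\dashv b$, $(a\dashv b)\dashv c-a\dashv(b\dashv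 c)=(b\vdash a)\dashv c-b\vdash(a\dashv c)$, $\ (a\vdash b)\dashv c=(a\vdash c)\vdash b$. Let $\mathrm{di}\text{-}\mathrm{Nov}\langle X\rangle$ be the free Novikov dialgebra on $X$, with $a\succ b=b\dashv a$ and $a\prec b=a\vdash b$, and let $\iota:\mathrm{di}\text{-}\mathrm{Nov}\langle X\rangle\to\mathrm{DerPerm}\langle X\rangle$ be the homomorphism with $\iota(x)=x$ for $x\in X$, where $\mathrm{DerPerm}\langle X\rangle$ is a Novikov dialgebra under $u\vdash v=u\,d(v)$, $u\dashv v=d(v)u$. Then: 1. $\iota$ is injective, and its image is the span of the monomials of weight $-1$. It maps the $\succ$-subalgebra (respectively, the $\prec$-subalgebra) generated by $X$ in $\mathrm{di}\text{-}\mathrm{Nov}\langle X\rangle$ onto $\mathrm{DerPerm}_\succ\langle X\rangle$ (respectively, $\mathrm{DerPerm}_\prec\langle X\rangle$). Identify these algebras along $\iota$. 2. $\mathrm{di}\text{-}\mathrm{Nov}\langle X\rangle=\mathrm{DerPerm}_\succ\langle X\rangle+\mathrm{DerPerm}_\prec\langle X\rangle$, and the intersection of the two summands is exactly the span of the generators $X$.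 3. Counting the generators once, the sum is direct: if $\mathrm{DerPerm}_\prec\langle X\rangle^2$ denotes the span of all products $u\prec v$ with $u,v\in\mathrm{DerPerm}_\prec\langle X\rangle$, then, as a vector space, $$\mathrm{di}\text{-}\mathrm{Nov}\langle X\rangle=\mathrm{DerPerm}_\succ\langle X\rangle\oplus\mathrm{DerPerm}_\prec\langle X\rangle^2,$$ that is, every element of $\mathrm{di}\text{-}\mathrm{Nov}\langle X\rangle$ can be written in a unique way as a sum of an element of the first and an element of the second space. 4. $\mathrm{DerPerm}_\succ\langle X\rangle$ is the span of the monomials with $\mathrm{wt}=-1$ and $k_n=0$; $\mathrm{DerPerm}_\prec\langle X\rangle^2$ is the span of the monomials with $\mathrm{wt}=-1$ and $k_n\ne 0$; and $\mathrm{DerPerm}_\prec\langle X\rangle$ is the sum of the latter and the span of $X$. -/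

import Mathlib

noncomputable section

/-! ### Subspaces generated by a bilinear operation -/

/-- The subalgebra generated by a set `S` in an algebra `A` with one bilinear operation `op`:
the smallest subspace that contains `S` and is closed under `op`. -/
def opClosure {K A : Type*} [Field K] [AddCommGroup A] [Module K A]
    (op : A →ₗ[K] A →ₗ[K] A) (S : Set A) : Submodule K A :=
  sInf {N : Submodule K A | S ⊆ N ∧ ∀ a ∈ N, ∀ b ∈ N, op a b ∈ N}

/-- The span of all the products `op a b` of two elements of a subspace `N`. -/
def opSquare {K A : Type*} [Field K] [AddCommGroup A] [Module K A]
    (op : A →ₗ[K] A →ₗ[K] A) (N : Submodule K A) : Submodule K A :=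
  Submodule.span K {c : A | ∃ a ∈ N, ∃ b ∈ N, c = op a b}

/-! ### Novikov dialgebras -/

/-- A Novikov dialgebra: a vector space with two bilinear operations
`vd a b = a ⊢ b` and `dv a b = a ⊣ b` that satisfy the identities below. -/
structure IsNovikovDialgebra {K A : Type*} [Field K] [AddCommGroup A] [Module K A]
    (vd dv : A →ₗ[K] A →ₗ[K] A) : Prop where
  zero_left : ∀ a b c, vd (dv a b) c = vd (vd a b) c
  zero_right : ∀ a b c, dv a (vd b c) = dv a (dv b c)
  lsym : ∀ a b c, vd (vd a b) c - vd a (vd b c) = vd (vd b a) c - vd b (vd a c)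
  rcom : ∀ a b c, dv (dv a b) c = dv (dv a c) b
  lsym_mixed : ∀ a b c, dv (dv a b) c - dv a (dv b c) = dv (vd b a) c - vd b (dv a c)
  rcom_mixed : ∀ a b c, dv (vd a b) c = vd (vd a c) b

/-- Nonassociative words in the alphabet `X` with two binary operations. -/
inductive DiWord (X : Type*) : Type _
  | of : X → DiWord X
  | vd : DiWord X → DiWord X → DiWord X
  | dv : DiWord X → DiWord X → DiWord X

/-- The free (nonassociative) algebra with two bilinear operations: its basis is the set of
words. -/
abbrev FreeDi (K X : Type*) [Field K] := DiWord X →₀ K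

namespace FreeDi

variable (K X : Type*) [Field K]

/-- The bilinear extension of the operation `⊢` on words. -/
def vd : FreeDi K X →ₗ[K] FreeDi K X →ₗ[K] FreeDi K X :=
  Finsupp.linearCombination K fun u => Finsupp.lmapDomain K K (DiWord.vd u)

/-- The bilinear extension of the operation `⊣` on words. -/
def dv : FreeDi K X →ₗ[K] FreeDi K X →ₗ[K] FreeDi K X :=
  Finsupp.linearCombination K fun u => Finsupp.lmapDomain K K (DiWord.dv u)

/-- The elements obtained from instances of the identities of Novikov dialgebras by repeated
multiplication with arbitrary elements, on either side and by either operation. -/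
inductive Relator : FreeDi K X → Prop
  | zero_left (a b c) : Relator (vd K X (dv K X a b) c - vd K X (vd K X a b) c)
  | zero_right (a b c) : Relator (dv K X a (vd K X b c) - dv K X a (dv K X b c))
  | lsym (a b c) : Relator ((vd K X (vd K X a b) c - vd K X a (vd K X b c))
      - (vd K X (vd K X b a) c - vd K X b (vd K X a c)))
  | rcom (a b c) : Relator (dv K X (dv K X a b) c - dv K X (dv K X a c) b)
  | lsym_mixed (a b c) : Relator ((dv K X (dv K X a b) c - dv K X a (dv K X b c))
      - (dv K X (vd K X b a) c - vd K X b (dv K X a c)))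
  | rcom_mixed (a b c) : Relator (dv K X (vd K X a b) c - vd K X (vd K X a c) b)
  | vd_mul (a u) : Relator u → Relator (vd K X a u)
  | mul_vd (a u) : Relator u → Relator (vd K X u a)
  | dv_mul (a u) : Relator u → Relator (dv K X a u)
  | mul_dv (a u) : Relator u → Relator (dv K X u a)

/-- The two-sided ideal generated by the identities of Novikov dialgebras. -/
def novIdeal : Submodule K (FreeDi K X) := Submodule.span K {u | Relator K X u}

variable {K X}

theorem mem_novIdeal_map (f : FreeDi K X →ₗ[K] FreeDi K X)
    (hf : ∀ u, Relator K X u → Relator K X (f u)) :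
    novIdeal K X ≤ (novIdeal K X).comap f :=
  Submodule.span_le.2 fun u hu => Submodule.subset_span (hf u hu)

end FreeDi

/-- A bilinear operation that maps `A × I` and `I × A` into a subspace `I` of `A` descends to
the quotient `A ⧸ I`. -/
def quotOp {K A : Type*} [Field K] [AddCommGroup A] [Module K A] (I : Submodule K A)
    (op : A →ₗ[K] A →ₗ[K] A) (h₁ : ∀ a, I ≤ I.comap (op a)) (h₂ : ∀ a, I ≤ I.comap (op.flip a)) :
    (A ⧸ I) →ₗ[K] (A ⧸ I) →ₗ[K] (A ⧸ I) :=
  I.liftQ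
    { toFun := fun a => I.mapQ I (op a) (h₁ a)
      map_add' := fun a b => by
        apply Submodule.linearMap_qext; ext c; simp
      map_smul' := fun r a => by
        apply Submodule.linearMap_qext; ext c; simp }
    (fun a ha => by
      rw [LinearMap.mem_ker]
      apply Submodule.linearMap_qext
      apply LinearMap.ext
      intro c
      exact (Submodule.Quotient.mk_eq_zero I).2 (h₂ c ha))

/-- The free Novikov dialgebra `di-Nov⟨X⟩`: the free algebra with two bilinear operations modulo
the ideal generated by the identities of Novikov dialgebras. -/
abbrev DiNov (K X : Type*) [Field K] := FreeDi K X ⧸ FreeDi.novIdeal K X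

namespace DiNov

variable (K X : Type*) [Field K]

/-- The operation `a ⊢ b` of the free Novikov dialgebra. -/
def vd : DiNov K X →ₗ[K] DiNov K X →ₗ[K] DiNov K X :=
  quotOp _ (FreeDi.vd K X)
    (fun a => FreeDi.mem_novIdeal_map _ fun u hu => .vd_mul a u hu)
    (fun a => FreeDi.mem_novIdeal_map _ fun u hu => .mul_vd a u hu)

/-- The operation `a ⊣ b` of the free Novikov dialgebra. -/
def dv : DiNov K X →ₗ[K] DiNov K X →ₗ[K] DiNov K X :=
  quotOp _ (FreeDi.dv K X)
    (fun a => FreeDi.mem_novIdeal_map _ fun u hu => .dv_mul a u hu)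
    (fun a => FreeDi.mem_novIdeal_map _ fun u hu => .mul_dv a u hu)

/-- The operation `a ≻ b = b ⊣ a`. -/
def succ : DiNov K X →ₗ[K] DiNov K X →ₗ[K] DiNov K X := (dv K X).flip

/-- The operation `a ≺ b = a ⊢ b`. -/
def prec : DiNov K X →ₗ[K] DiNov K X →ₗ[K] DiNov K X := vd K X

variable {X}

/-- The generators of the free Novikov dialgebra. -/
def of (x : X) : DiNov K X :=
  (FreeDi.novIdeal K X).mkQ (Finsupp.single (DiWord.of x) 1)

variable (X)

theorem isNovikovDialgebra : IsNovikovDialgebra (vd K X) (dv K X) := by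
  have key : ∀ u, FreeDi.Relator K X u → (FreeDi.novIdeal K X).mkQ u = 0 := fun u hu =>
    (Submodule.Quotient.mk_eq_zero _).2 (Submodule.subset_span hu)
  have hv : ∀ a b, vd K X ((FreeDi.novIdeal K X).mkQ a) ((FreeDi.novIdeal K X).mkQ b)
      = (FreeDi.novIdeal K X).mkQ (FreeDi.vd K X a b) := fun _ _ => rfl
  have hd : ∀ a b, dv K X ((FreeDi.novIdeal K X).mkQ a) ((FreeDi.novIdeal K X).mkQ b)
      = (FreeDi.novIdeal K X).mkQ (FreeDi.dv K X a b) := fun _ _ => rfl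
  constructor <;> intro a b c <;>
    obtain ⟨a, rfl⟩ := Submodule.mkQ_surjective _ a <;>
    obtain ⟨b, rfl⟩ := Submodule.mkQ_surjective _ b <;>
    obtain ⟨c, rfl⟩ := Submodule.mkQ_surjective _ c <;>
    simp only [hv, hd, ← map_sub] <;> rw [← sub_eq_zero, ← map_sub] <;> apply key
  · exact .zero_left a b c
  · exact .zero_right a b c
  · exact .lsym a b c
  · exact .rcom a b c
  · exact .lsym_mixed a b c
  · exact .rcom_mixed a b c

end DiNov

section Lift

variable {K X A : Type*} [Field K] [AddCommGroup A] [Module K A]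

/-- The value of a word under a map of the alphabet into an algebra with two operations. -/
def DiWord.eval (vd dv : A →ₗ[K] A →ₗ[K] A) (f : X → A) : DiWord X → A
  | .of x => f x
  | .vd u v => vd (u.eval vd dv f) (v.eval vd dv f)
  | .dv u v => dv (u.eval vd dv f) (v.eval vd dv f)

/-- The linear extension of `DiWord.eval`. -/
def FreeDi.eval (vd dv : A →ₗ[K] A →ₗ[K] A) (f : X → A) : FreeDi K X →ₗ[K] A :=
  Finsupp.linearCombination K (DiWord.eval vd dv f)

theorem FreeDi.eval_vd (vd dv : A →ₗ[K] A →ₗ[K] A) (f : X → A) (a b : FreeDi K X) :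
    FreeDi.eval vd dv f (FreeDi.vd K X a b)
      = vd (FreeDi.eval vd dv f a) (FreeDi.eval vd dv f b) := by
  have : (FreeDi.vd K X).compr₂ (FreeDi.eval vd dv f)
      = vd.compl₁₂ (FreeDi.eval vd dv f) (FreeDi.eval vd dv f) := by
    ext u v
    simp [FreeDi.eval, FreeDi.vd, DiWord.eval, Finsupp.lmapDomain_apply, Finsupp.mapDomain_single]
  exact LinearMap.congr_fun₂ this a b

theorem FreeDi.eval_dv (vd dv : A →ₗ[K] A →ₗ[K] A) (f : X → A) (a b : FreeDi K X) :
    FreeDi.eval vd dv f (FreeDi.dv K X a b)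
      = dv (FreeDi.eval vd dv f a) (FreeDi.eval vd dv f b) := by
  have : (FreeDi.dv K X).compr₂ (FreeDi.eval vd dv f)
      = dv.compl₁₂ (FreeDi.eval vd dv f) (FreeDi.eval vd dv f) := by
    ext u v
    simp [FreeDi.eval, FreeDi.dv, DiWord.eval, Finsupp.lmapDomain_apply, Finsupp.mapDomain_single]
  exact LinearMap.congr_fun₂ this a b

theorem FreeDi.eval_relator {vd dv : A →ₗ[K] A →ₗ[K] A} (h : IsNovikovDialgebra vd dv) (f : X → A)
    (u : FreeDi K X) (hu : FreeDi.Relator K X u) : FreeDi.eval vd dv f u = 0 := by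
  induction hu with
  | zero_left a b c => simp [FreeDi.eval_vd, FreeDi.eval_dv, h.zero_left]
  | zero_right a b c => simp [FreeDi.eval_vd, FreeDi.eval_dv, h.zero_right]
  | lsym a b c => simp [FreeDi.eval_vd, h.lsym (FreeDi.eval vd dv f a)]
  | rcom a b c =>
    simp [FreeDi.eval_dv, h.rcom _ (FreeDi.eval vd dv f b) (FreeDi.eval vd dv f c)]
  | lsym_mixed a b c => simp [FreeDi.eval_vd, FreeDi.eval_dv, h.lsym_mixed]
  | rcom_mixed a b c => simp [FreeDi.eval_vd, FreeDi.eval_dv, h.rcom_mixed]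
  | vd_mul a u _ ih => simp [FreeDi.eval_vd, ih]
  | mul_vd a u _ ih => simp [FreeDi.eval_vd, ih]
  | dv_mul a u _ ih => simp [FreeDi.eval_dv, ih]
  | mul_dv a u _ ih => simp [FreeDi.eval_dv, ih]

/-- The homomorphism from the free Novikov dialgebra to a Novikov dialgebra `A` that extends a
map `f : X → A`. -/
def DiNov.lift {vd dv : A →ₗ[K] A →ₗ[K] A} (h : IsNovikovDialgebra vd dv) (f : X → A) :
    DiNov K X →ₗ[K] A :=
  (FreeDi.novIdeal K X).liftQ (FreeDi.eval vd dv f)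
    (Submodule.span_le.2 fun u hu => FreeDi.eval_relator h f u hu)

theorem DiNov.lift_of {vd dv : A →ₗ[K] A →ₗ[K] A} (h : IsNovikovDialgebra vd dv) (f : X → A)
    (x : X) : DiNov.lift h f (DiNov.of K x) = f x := by
  simp [DiNov.lift, DiNov.of, FreeDi.eval, DiWord.eval]

theorem DiNov.lift_vd {vd dv : A →ₗ[K] A →ₗ[K] A} (h : IsNovikovDialgebra vd dv) (f : X → A)
    (a b : DiNov K X) :
    DiNov.lift h f (DiNov.vd K X a b) = vd (DiNov.lift h f a) (DiNov.lift h f b) := by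
  obtain ⟨a, rfl⟩ := Submodule.mkQ_surjective _ a
  obtain ⟨b, rfl⟩ := Submodule.mkQ_surjective _ b
  exact FreeDi.eval_vd vd dv f a b

theorem DiNov.lift_dv {vd dv : A →ₗ[K] A →ₗ[K] A} (h : IsNovikovDialgebra vd dv) (f : X → A)
    (a b : DiNov K X) :
    DiNov.lift h f (DiNov.dv K X a b) = dv (DiNov.lift h f a) (DiNov.lift h f b) := by
  obtain ⟨a, rfl⟩ := Submodule.mkQ_surjective _ a
  obtain ⟨b, rfl⟩ := Submodule.mkQ_surjective _ b
  exact FreeDi.eval_dv vd dv f a b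

end Lift

/-! ### The free perm algebra with a derivation -/

/-- The free perm algebra with a derivation `DerPerm⟨X⟩`, in terms of its basis: the free perm
algebra on the letters `x^(k)`, that is `(x, k) : X × ℕ`. A monomial `y₁ ⋯ yₙ₋₁ yₙ`, in which the
order of all the letters but the last one is irrelevant, is stored as the commutative monomial
`y₁ ⋯ yₙ₋₁` in position `yₙ`. -/
def DerPerm (K X : Type*) [Field K] := (X × ℕ) →₀ MvPolynomial (X × ℕ) K

namespace DerPerm

variable (K X : Type*) [Field K]

instance : AddCommGroup (DerPerm K X) :=
  inferInstanceAs (AddCommGroup ((X × ℕ) →₀ MvPolynomial (X × ℕ) K))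

instance : Module (MvPolynomial (X × ℕ) K) (DerPerm K X) :=
  inferInstanceAs (Module (MvPolynomial (X × ℕ) K) ((X × ℕ) →₀ MvPolynomial (X × ℕ) K))

instance : Module K (DerPerm K X) :=
  inferInstanceAs (Module K ((X × ℕ) →₀ MvPolynomial (X × ℕ) K))

instance : IsScalarTower K (MvPolynomial (X × ℕ) K) (DerPerm K X) :=
  inferInstanceAs
    (IsScalarTower K (MvPolynomial (X × ℕ) K) ((X × ℕ) →₀ MvPolynomial (X × ℕ) K))

/-- The commutative image of an element: `y₁ ⋯ yₙ₋₁ yₙ` is sent to the product of its letters in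
the polynomial algebra. -/
def toPoly : DerPerm K X →ₗ[MvPolynomial (X × ℕ) K] MvPolynomial (X × ℕ) K :=
  Finsupp.linearCombination (MvPolynomial (X × ℕ) K) MvPolynomial.X

/-- The product `(y₁ ⋯ yₙ) (z₁ ⋯ zₘ) = y₁ ⋯ yₙ z₁ ⋯ zₘ`. -/
instance : Mul (DerPerm K X) := ⟨fun u v => toPoly K X u • v⟩

variable {K X} in
theorem mul_def (u v : DerPerm K X) : u * v = toPoly K X u • v := rfl

instance : NonUnitalRing (DerPerm K X) :=
  { (inferInstance : AddCommGroup (DerPerm K X)), (inferInstance : Mul (DerPerm K X)) with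
    left_distrib := fun u v w => smul_add _ v w
    right_distrib := fun u v w => by simp only [mul_def, map_add, add_smul]
    zero_mul := fun u => by simp only [mul_def, map_zero, zero_smul]
    mul_zero := fun u => smul_zero _
    mul_assoc := fun u v w => by simp only [mul_def, map_smul, smul_eq_mul, mul_smul] }

instance : IsScalarTower K (DerPerm K X) (DerPerm K X) :=
  ⟨fun r u v => by
    simp only [smul_eq_mul, mul_def]
    rw [LinearMap.map_smul_of_tower, smul_assoc]⟩

instance : SMulCommClass K (DerPerm K X) (DerPerm K X) :=
  ⟨fun r u v => by
    simp only [smul_eq_mul, mul_def]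
    rw [← algebraMap_smul (MvPolynomial (X × ℕ) K) r v,
      ← algebraMap_smul (MvPolynomial (X × ℕ) K) r (toPoly K X u • v), smul_comm]⟩

/-- `DerPerm⟨X⟩` is left-commutative. -/
theorem left_comm (u v w : DerPerm K X) : u * (v * w) = v * (u * w) := by
  simp only [mul_def]
  exact smul_comm _ _ _

/-- The letter `x^(k)`. -/
def letter {X : Type*} (y : X × ℕ) : DerPerm K X :=
  Finsupp.single y (1 : MvPolynomial (X × ℕ) K)

/-- The generators `x = x^(0)`. -/
def of {X : Type*} (x : X) : DerPerm K X := letter K (x, 0)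

/-- The derivation of the polynomial algebra with `x^(k) ↦ x^(k+1)`. -/
def polyD : Derivation K (MvPolynomial (X × ℕ) K) (MvPolynomial (X × ℕ) K) :=
  MvPolynomial.mkDerivation K fun y => MvPolynomial.X (y.1, y.2 + 1)

/-- The derivation of `DerPerm⟨X⟩` with `x^(k) ↦ x^(k+1)`; on the element given by a commutative
polynomial `p` followed by a last letter `y` it is `p y ↦ p' y + p y'`. -/
def d : DerPerm K X →ₗ[K] DerPerm K X :=
  Finsupp.lsum K fun y =>
    ((Finsupp.lsingle y : MvPolynomial (X × ℕ) K →ₗ[K] ((X × ℕ) →₀ MvPolynomial (X × ℕ) K)).comp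
        (polyD K X : MvPolynomial (X × ℕ) K →ₗ[K] MvPolynomial (X × ℕ) K)
      + Finsupp.lsingle (y.1, y.2 + 1))

variable {K X}

theorem single_eq_smul (y : X × ℕ) (p : MvPolynomial (X × ℕ) K) :
    (Finsupp.single y p : DerPerm K X) = p • letter K y := by
  refine Eq.trans ?_ (Finsupp.smul_single p y (1 : MvPolynomial (X × ℕ) K)).symm
  rw [smul_eq_mul, mul_one]

theorem induction_on {P : DerPerm K X → Prop} (u : DerPerm K X) (h0 : P 0)
    (hadd : ∀ u v, P u → P v → P (u + v))
    (hs : ∀ (p : MvPolynomial (X × ℕ) K) (y : X × ℕ), P (p • letter K y)) : P u :=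
  Finsupp.induction_linear u h0 hadd fun y p => by
    have := hs p y
    rwa [← single_eq_smul] at this

theorem toPoly_letter (y : X × ℕ) : toPoly K X (letter K y) = MvPolynomial.X y := by
  refine (Finsupp.linearCombination_single _ _ _).trans ?_
  rw [one_smul]

theorem d_smul_letter (p : MvPolynomial (X × ℕ) K) (y : X × ℕ) :
    d K X (p • letter K y) = polyD K X p • letter K y + p • letter K (y.1, y.2 + 1) := by
  rw [← single_eq_smul, ← single_eq_smul, ← single_eq_smul]
  exact Finsupp.lsum_single (M := MvPolynomial (X × ℕ) K) _ _ y p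

theorem d_letter (y : X × ℕ) : d K X (letter K y) = letter K (y.1, y.2 + 1) := by
  have := d_smul_letter (K := K) 1 y
  simpa using this

theorem d_smul (p : MvPolynomial (X × ℕ) K) (u : DerPerm K X) :
    d K X (p • u) = polyD K X p • u + p • d K X u := by
  induction u using induction_on with
  | h0 => simp
  | hadd u v hu hv => simp only [smul_add, map_add, hu, hv]; abel
  | hs q y =>
    rw [← mul_smul, d_smul_letter, d_smul_letter, Derivation.leibniz]
    simp only [smul_eq_mul, smul_add, add_smul, mul_smul]
    rw [smul_comm q]
    abel

theorem toPoly_d (u : DerPerm K X) : toPoly K X (d K X u) = polyD K X (toPoly K X u) := by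
  induction u using induction_on with
  | h0 => simp
  | hadd u v hu hv => simp only [map_add, hu, hv]
  | hs q y =>
    simp [d_smul_letter, toPoly_letter, Derivation.leibniz, polyD, MvPolynomial.mkDerivation_X]
    ring

/-- The Leibniz rule. -/
theorem d_mul (u v : DerPerm K X) : d K X (u * v) = d K X u * v + u * d K X v := by
  simp only [mul_def, d_smul, toPoly_d]

/-- The letter `x^(k)` is the `k`-th derivative of the generator `x`. -/
theorem iterate_d_of (x : X) (k : ℕ) : (d K X)^[k] (of K x) = letter K (x, k) := by
  induction k with
  | zero => rfl
  | succ k ih => rw [Function.iterate_succ_apply', ih, d_letter]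

/-- Left multiplications in a perm algebra commute, hence polynomials act on the algebra. -/
theorem exists_polyAction {B : Type*} [NonUnitalRing B] [Module K B] [IsScalarTower K B B]
    [SMulCommClass K B B] (hB : ∀ a b c : B, a * (b * c) = b * (a * c))
    {Y : Type*} (g : Y → B) :
    ∃ F : MvPolynomial Y K →ₐ[K] Module.End K B,
      ∀ y, F (MvPolynomial.X y) = LinearMap.mulLeft K (g y) := by
  let s : Set (Module.End K B) := Set.range fun y => LinearMap.mulLeft K (g y)
  have hs : ∀ a ∈ s, ∀ b ∈ s, a * b = b * a := by
    rintro _ ⟨y, rfl⟩ _ ⟨z, rfl⟩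
    ext c
    exact hB _ _ _
  have hc := Algebra.isMulCommutative_adjoin K hs
  let _ : CommRing (Algebra.adjoin K s) :=
    { (inferInstance : Ring (Algebra.adjoin K s)) with mul_comm := hc.is_comm.comm }
  refine ⟨(Algebra.adjoin K s).val.comp (MvPolynomial.aeval fun y =>
    (⟨LinearMap.mulLeft K (g y), Algebra.subset_adjoin ⟨y, rfl⟩⟩ : Algebra.adjoin K s)), fun y => ?_⟩
  simp

/-- `DerPerm⟨X⟩` is free: a map from `X` to a perm algebra with a derivation extends uniquely to
a homomorphism that commutes with the derivations. -/
theorem existsUnique_lift {B : Type*} [NonUnitalRing B] [Module K B] [IsScalarTower K B B]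
    [SMulCommClass K B B] (hB : ∀ a b c : B, a * (b * c) = b * (a * c)) (D : B →ₗ[K] B)
    (hD : ∀ a b, D (a * b) = D a * b + a * D b) (f : X → B) :
    ∃! φ : DerPerm K X →ₗ[K] B, (∀ x, φ (of K x) = f x) ∧
      (∀ u v, φ (u * v) = φ u * φ v) ∧ ∀ u, φ (d K X u) = D (φ u) := by
  let g : X × ℕ → B := fun y => D^[y.2] (f y.1)
  have hg : ∀ y : X × ℕ, g (y.1, y.2 + 1) = D (g y) := fun y =>
    Function.iterate_succ_apply' _ _ _
  obtain ⟨F, hF⟩ := exists_polyAction (K := K) hB g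
  have hF' : ∀ y b, F (MvPolynomial.X y) b = g y * b := fun y b => by rw [hF]; rfl
  have hF1 : ∀ p a b, F p (a * b) = F p a * b := by
    intro p
    induction p using MvPolynomial.induction_on with
    | C r =>
      intro a b
      have : F (MvPolynomial.C r) = algebraMap K _ r := F.commutes r
      simp [this, Module.algebraMap_end_apply, smul_mul_assoc]
    | add p q hp hq => intro a b; simp [hp, hq, add_mul]
    | mul_X p y hp =>
      intro a b
      simp only [map_mul, Module.End.mul_apply, hF', ← hp, mul_assoc]
  have hF2 : ∀ p b, D (F p b) = F (polyD K X p) b + F p (D b) := by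
    intro p
    induction p using MvPolynomial.induction_on with
    | C r =>
      intro b
      have : F (MvPolynomial.C r) = algebraMap K _ r := F.commutes r
      have h0 : polyD K X (MvPolynomial.C r) = 0 := MvPolynomial.derivation_C _ r
      simp [this, h0, Module.algebraMap_end_apply]
    | add p q hp hq => intro b; simp [hp, hq]; abel
    | mul_X p y hp =>
      intro b
      have h1 : polyD K X (MvPolynomial.X y) = MvPolynomial.X (y.1, y.2 + 1) :=
        MvPolynomial.mkDerivation_X K _ y
      have h2 : F (polyD K X p) (g y * b) = g y * F (polyD K X p) b := by
        rw [← hF', ← hF', ← Module.End.mul_apply, ← Module.End.mul_apply, ← map_mul, ← map_mul,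
          mul_comm]
      rw [Derivation.leibniz, h1]
      simp only [map_mul, map_add, Module.End.mul_apply, LinearMap.add_apply, smul_eq_mul, hF', hp,
        hD, hg, h2]
      abel
  let φ : DerPerm K X →ₗ[K] B :=
    Finsupp.lsum K fun y => (LinearMap.applyₗ (g y)).comp F.toLinearMap
  have hφ : ∀ p y, φ (p • letter K y) = F p (g y) := fun p y => by
    rw [← single_eq_smul]
    exact Finsupp.lsum_single (M := MvPolynomial (X × ℕ) K) _ _ y p
  have hφ1 : ∀ u b, F (toPoly K X u) b = φ u * b := by
    intro u b
    induction u using induction_on with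
    | h0 => simp
    | hadd u v hu hv => simp [hu, hv, add_mul]
    | hs p y => simp [hφ, toPoly_letter, hF', hF1]
  have hφ2 : ∀ p u, φ (p • u) = F p (φ u) := by
    intro p u
    induction u using induction_on with
    | h0 => simp
    | hadd u v hu hv => simp [hu, hv]
    | hs q y => rw [← mul_smul, hφ, hφ, map_mul, Module.End.mul_apply]
  refine ⟨φ, ⟨fun x => ?_, fun u v => ?_, fun u => ?_⟩, ?_⟩
  · have := hφ 1 (x, 0)
    rw [one_smul, map_one] at this
    exact this
  · rw [mul_def, hφ2, hφ1]
  · induction u using induction_on with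
    | h0 => simp
    | hadd u v hu hv => simp [hu, hv]
    | hs p y => rw [d_smul_letter, map_add, hφ, hφ, hφ, hF2, hg]
  · rintro ψ ⟨h1, h2, h3⟩
    have hl : ∀ y : X × ℕ, ψ (letter K y) = g y := by
      rintro ⟨x, k⟩
      induction k with
      | zero => exact h1 x
      | succ k ih => rw [hg (x, k), ← ih, ← h3, d_letter]
    have hp : ∀ p u, ψ (p • u) = F p (ψ u) := by
      intro p
      induction p using MvPolynomial.induction_on with
      | C r =>
        intro u
        have : F (MvPolynomial.C r) = algebraMap K _ r := F.commutes r
        rw [this, Module.algebraMap_end_apply, ← map_smul, ← MvPolynomial.algebraMap_eq,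
          algebraMap_smul]
      | add p q hp hq => intro u; simp [add_smul, hp, hq]
      | mul_X p y hp =>
        intro u
        rw [mul_smul, hp, map_mul, Module.End.mul_apply, hF', ← hl, ← h2, mul_def, toPoly_letter]
    ext u
    induction u using induction_on with
    | h0 => simp
    | hadd u v hu hv => simp [hu, hv]
    | hs p y => rw [hp, hφ, hl]

variable (K X)

/-- The operation `u ≻ v = d(u) v` on `DerPerm⟨X⟩`. -/
def succ : DerPerm K X →ₗ[K] DerPerm K X →ₗ[K] DerPerm K X :=
  (LinearMap.mul K (DerPerm K X)).comp (d K X)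

/-- The operation `u ≺ v = u d(v)` on `DerPerm⟨X⟩`. -/
def prec : DerPerm K X →ₗ[K] DerPerm K X →ₗ[K] DerPerm K X :=
  (LinearMap.mul K (DerPerm K X)).compl₂ (d K X)

/-- The algebra `DerPerm_≻⟨X⟩`: the subalgebra of `DerPerm⟨X⟩` under `≻` generated by `X`. -/
def succAlg : Submodule K (DerPerm K X) := opClosure (succ K X) (Set.range (of K))

/-- The algebra `DerPerm_≺⟨X⟩`: the subalgebra of `DerPerm⟨X⟩` under `≺` generated by `X`. -/
def precAlg : Submodule K (DerPerm K X) := opClosure (prec K X) (Set.range (of K))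

/-- The monomial `y₁ (y₂ (⋯ (yₙ₋₁ y)))` in the letters `x^(k)`, given by the list
`l = [y₁, …, yₙ₋₁]` and the last letter `y`. -/
def monomial {X : Type*} (l : List (X × ℕ)) (y : X × ℕ) : DerPerm K X :=
  l.foldr (fun z u => letter K z * u) (letter K y)

/-- The weight of the monomial given by `l` and `y`: each letter `x^(k)` contributes `k - 1`. -/
def weight {X : Type*} (l : List (X × ℕ)) (y : X × ℕ) : ℤ :=
  (l.map fun z => (z.2 : ℤ) - 1).sum + ((y.2 : ℤ) - 1)

/-- The span of the monomials of weight `-1`. -/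
def weightNegOne : Submodule K (DerPerm K X) :=
  Submodule.span K {u | ∃ l y, weight l y = -1 ∧ u = monomial K l y}

/-- The span of the monomials of weight `-1` whose last letter is `x^(k)` with `k = 0`. -/
def weightNegOneZero : Submodule K (DerPerm K X) :=
  Submodule.span K {u | ∃ l y, weight l y = -1 ∧ y.2 = 0 ∧ u = monomial K l y}

/-- The span of the monomials of weight `-1` whose last letter is `x^(k)` with `k ≠ 0`. -/
def weightNegOnePos : Submodule K (DerPerm K X) :=
  Submodule.span K {u | ∃ l y, weight l y = -1 ∧ y.2 ≠ 0 ∧ u = monomial K l y}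

/-- `DerPerm⟨X⟩` is a Novikov dialgebra under `u ⊢ v = u d(v)` and `u ⊣ v = d(v) u`. -/
theorem isNovikovDialgebra : IsNovikovDialgebra (prec K X) (succ K X).flip := by
  have hp : ∀ u v, prec K X u v = u * d K X v := fun _ _ => rfl
  have hs : ∀ u v, (succ K X).flip u v = d K X v * u := fun _ _ => rfl
  have hl := left_comm K X
  constructor <;> intro a b c <;> simp only [hp, hs, d_mul, mul_add, add_mul, mul_assoc]
  · rw [hl]
  · rw [hl b, hl (d K X b), add_comm]
  · rw [hl b a, hl a b]; abel
  · rw [hl]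
  · rw [hl b (d K X (d K X c)), hl b (d K X c)]; abel
  · rw [hl]

end DerPerm

/-- The canonical homomorphism from the free Novikov dialgebra to `DerPerm⟨X⟩` under
`u ⊢ v = u d(v)` and `u ⊣ v = d(v) u`, with `x ↦ x` on the generators. -/
def DiNov.toDerPerm (K X : Type*) [Field K] : DiNov K X →ₗ[K] DerPerm K X :=
  DiNov.lift (DerPerm.isNovikovDialgebra K X) (DerPerm.of K)

namespace DiNov

variable (K X : Type*) [Field K]

/-- The subalgebra of the free Novikov dialgebra under `≻` generated by `X`. -/
def succAlg : Submodule K (DiNov K X) := opClosure (succ K X) (Set.range (of K))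

/-- The subalgebra of the free Novikov dialgebra under `≺` generated by `X`. -/
def precAlg : Submodule K (DiNov K X) := opClosure (prec K X) (Set.range (of K))

end DiNov

end

/-!
The image of `ι : di-Nov⟨X⟩ → DerPerm⟨X⟩` and the subalgebras generated by `X` are found inside
`DerPerm⟨X⟩`, where everything is graded by weight and split by the order of the last letter. The
difficulty is the injectivity of `ι`, an upper bound for an algebra given by identities.

*Novikov algebras.* In a Novikov algebra, with product thought of as `u v'`, right multiplications
commute, and left symmetry says that `s' a b := μ a (s b) - s (μ a b)` is symmetric in `a`, `b` when
`s` is a right multiplication. This symmetry passes to the whole algebra of operators generated by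
right multiplications (`IsNovikov.defect_symm`). It allows one to define, by recursion on `k`,
operators `blockOp` that behave as the multiplications by `x^(k+1) y₁ ⋯ yₖ`, and to show that
`x^(k+1) y₁ ⋯ yₖ z` is symmetric in `y₁, …, yₖ, z` (`IsNovikov.blockOp_swap`). Products of blocks
applied to a generator span the subalgebra that the generators give rise to
(`IsNovikov.mul_mem_wordSpan`),
and by the symmetry such a product depends only on the multiset of its letters. Hence a homomorphism
to differential polynomials that is the identity on generators is injective on the subalgebra
generated by them (`IsNovikov.eq_zero_of_map_eq_zero`).

*Dialgebras.* A Novikov dialgebra `A` is a bimodule over the Novikov algebra `A ⧸ I`, where `I` is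
its annihilator, and the split null extension `(A ⧸ I) × A` is a Novikov algebra. On the side of
`DerPerm⟨X⟩` this corresponds to marking the last letter, taking it from a second copy of `X`. For
`A = di-Nov⟨X⟩` the pairs `(mark (ι u), (0, u))` lie in the subalgebra generated by `X ⊕ X` in the
product of the polynomial algebra and the split null extension, so `ι u = 0` implies `u = 0`
(`DiNov.toDerPerm_injective`).

*The two subalgebras.* Polynomials of weight zero are generated by the blocks, and these map
`DerPerm_≻⟨X⟩` into itself since `u ≻ v = u' v` (`DerPerm.block_mem_succStabilizer`); this gives all
monomials of weight `-1` with last letter of order zero. The commutative images of `DerPerm_≻⟨X⟩` and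
`DerPerm_≺⟨X⟩` agree, so `p v'` is a `≺`-product for every `p` of weight `-1` and every `v` in
`DerPerm_≺⟨X⟩`; induction on the order of the last letter gives all monomials of weight `-1` with last
letter of positive order (`DerPerm.smul_letter_mem_opSquare`). The statements about `di-Nov⟨X⟩` are
pulled back along `ι`.
-/

/-- A Novikov algebra: a vector space with a left-symmetric bilinear operation whose right
multiplications commute. -/
structure IsNovikov {K E : Type*} [Field K] [AddCommGroup E] [Module K E]
    (μ : E →ₗ[K] E →ₗ[K] E) : Prop where
  lsym : ∀ a b c, μ (μ a b) c - μ a (μ b c) = μ (μ b a) c - μ b (μ a c)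
  rcom : ∀ a b c, μ (μ a b) c = μ (μ a c) b

namespace IsNovikov

variable {K E : Type*} [Field K] [AddCommGroup E] [Module K E]

/-! ### Right multiplications of a Novikov algebra -/

/-- Right multiplication `a ↦ μ a b`, which in the model `μ u v = u v'` is multiplication by the
derivative of `b`. -/
def rmul (μ : E →ₗ[K] E →ₗ[K] E) (b : E) : Module.End K E := μ.flip b

@[simp] theorem rmul_apply (μ : E →ₗ[K] E →ₗ[K] E) (a b : E) : rmul μ b a = μ a b := rfl

/-- The algebra of operators generated by the right multiplications. -/
def rightAlg (μ : E →ₗ[K] E →ₗ[K] E) : Subalgebra K (Module.End K E) :=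
  Algebra.adjoin K (Set.range (rmul μ))

theorem rmul_mem_rightAlg (μ : E →ₗ[K] E →ₗ[K] E) (b : E) : rmul μ b ∈ rightAlg μ :=
  Algebra.subset_adjoin ⟨b, rfl⟩

variable {μ : E →ₗ[K] E →ₗ[K] E}

theorem comm_of_mem (h : IsNovikov μ) {s t : Module.End K E} (hs : s ∈ rightAlg μ)
    (ht : t ∈ rightAlg μ) (a : E) : s (t a) = t (s a) := by
  have hc : ∀ a ∈ Set.range (rmul μ), ∀ b ∈ Set.range (rmul μ), a * b = b * a := by
    rintro _ ⟨b, rfl⟩ _ ⟨c, rfl⟩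
    ext a
    exact h.rcom a c b
  have := (Algebra.isMulCommutative_adjoin K hc).is_comm.comm ⟨s, hs⟩ ⟨t, ht⟩
  exact LinearMap.congr_fun (congrArg Subtype.val this) a

theorem apply_mul (h : IsNovikov μ) {s : Module.End K E} (hs : s ∈ rightAlg μ) (a b : E) :
    s (μ a b) = μ (s a) b :=
  h.comm_of_mem hs (rmul_mem_rightAlg μ b) a

/-- The defect `μ a (s b) - s (μ a b)`, which in the model is `s' a b`, obeys the Leibniz rule
in `s`. -/
theorem defect_mul_of_symm (h : IsNovikov μ) {s t : Module.End K E} (hs : s ∈ rightAlg μ)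
    (ht : t ∈ rightAlg μ) (hsymm : ∀ a b, μ a (s b) - s (μ a b) = μ b (s a) - s (μ b a))
    (a b : E) :
    μ a (s (t b)) - s (t (μ a b)) =
      t (μ a (s b) - s (μ a b)) + s (μ a (t b) - t (μ a b)) := by
  have h1 := hsymm a (t b)
  have h2 := hsymm a b
  rw [← h.apply_mul ht, ← h.apply_mul ht, h.comm_of_mem hs ht, h.comm_of_mem hs ht,
    ← map_sub t, ← h2] at h1
  rw [← h1, map_sub s, h.comm_of_mem hs ht (μ a b), h.comm_of_mem hs ht b]
  abel

/-- Left symmetry says that the defect `s' a b` is symmetric when `s` is a right multiplication;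
this extends to the algebra that the right multiplications generate. -/
theorem defect_symm (h : IsNovikov μ) {s : Module.End K E} (hs : s ∈ rightAlg μ) (a b : E) :
    μ a (s b) - s (μ a b) = μ b (s a) - s (μ b a) := by
  unfold rightAlg at hs
  induction hs using Algebra.adjoin_induction generalizing a b with
  | mem s hs =>
    obtain ⟨c, rfl⟩ := hs
    have := h.lsym a b c
    simp only [rmul_apply]
    rw [← neg_inj, neg_sub, neg_sub, this]
  | algebraMap r => simp [Module.algebraMap_end_apply]
  | add s t _ _ ihs iht =>
    have h1 := ihs a b
    have h2 := iht a b
    simp only [LinearMap.add_apply, map_add]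
    rw [add_sub_add_comm, h1, h2, add_sub_add_comm]
  | mul s t hs ht ihs iht =>
    simp only [Module.End.mul_apply]
    rw [h.defect_mul_of_symm hs ht ihs a b, h.defect_mul_of_symm hs ht ihs b a, ihs a b, iht a b]

theorem defect_mul (h : IsNovikov μ) {s t : Module.End K E} (hs : s ∈ rightAlg μ)
    (ht : t ∈ rightAlg μ) (a b : E) :
    μ a (s (t b)) - s (t (μ a b)) =
      t (μ a (s b) - s (μ a b)) + s (μ a (t b) - t (μ a b)) :=
  h.defect_mul_of_symm hs ht (h.defect_symm hs) a b

/-! ### Multiplication by a weight-zero block -/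

open Classical in
/-- Recursion for `blockOp`, for a multiset `Y` whose cardinality is the numerical argument. An
arbitrary element of `Y` is singled out; by `blockOp_swap` the choice does not matter. The value `0`
for empty `Y` and positive first argument is a default that `blockOp` never meets. -/
noncomputable def blockAux (μ : E →ₗ[K] E →ₗ[K] E) (x : E) : ℕ → Multiset E → Module.End K E
  | 0, _ => rmul μ x
  | n + 1, Y =>
    if hY : ∃ c, c ∈ Y then
      rmul μ (blockAux μ x n (Y.erase hY.choose) hY.choose)
        - (Y.map fun z => blockAux μ x n (Y.erase z) * rmul μ z).sum
    else 0

/-- The operator that in the model `μ u v = u v'` is multiplication by `x^(k+1) y₁ ⋯ yₖ`, where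
`Y = {y₁, …, yₖ}`. The recursion solves the Leibniz rule for `(x^(k) y₁ ⋯ yₖ)'`. -/
noncomputable def blockOp (μ : E →ₗ[K] E →ₗ[K] E) (x : E) (Y : Multiset E) : Module.End K E :=
  blockAux μ x (Multiset.card Y) Y

theorem blockAux_mem (x : E) (n : ℕ) (Y : Multiset E) : blockAux μ x n Y ∈ rightAlg μ := by
  classical
  induction n generalizing Y with
  | zero => exact rmul_mem_rightAlg μ x
  | succ n ih =>
    rw [blockAux]
    split_ifs with hY
    · refine sub_mem (rmul_mem_rightAlg μ _) (multiset_sum_mem _ fun s hs => ?_)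
      obtain ⟨z, _, rfl⟩ := Multiset.mem_map.1 hs
      exact mul_mem (ih _) (rmul_mem_rightAlg μ z)
    · exact zero_mem _

theorem blockOp_mem (x : E) (Y : Multiset E) : blockOp μ x Y ∈ rightAlg μ := blockAux_mem x _ Y

theorem blockOp_zero (x : E) : blockOp μ x 0 = rmul μ x := rfl

open Classical in
theorem blockAux_cons_of_swap (x y : E) (W : Multiset E)
    (hsw : ∀ (V : Multiset E) (a b : E), Multiset.card V + 1 = Multiset.card W →
      blockOp μ x (a ::ₘ V) b = blockOp μ x (b ::ₘ V) a) :
    blockOp μ x (y ::ₘ W) = rmul μ (blockOp μ x W y) - blockOp μ x W * rmul μ y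
      - (W.map fun w => blockOp μ x (y ::ₘ W.erase w) * rmul μ w).sum := by
  have hY : ∃ c, c ∈ y ::ₘ W := ⟨y, Multiset.mem_cons_self y W⟩
  have haux : ∀ V : Multiset E, Multiset.card V = Multiset.card W →
      blockAux μ x (Multiset.card W) V = blockOp μ x V := fun V hV => by rw [blockOp, hV]
  -- the recursion does not depend on the element that is singled out
  have key : ∀ c ∈ y ::ₘ W,
      blockAux μ x (Multiset.card W) ((y ::ₘ W).erase c) c = blockOp μ x W y := by
    intro c hc
    by_cases hcy : c = y
    · subst hcy
      rw [Multiset.erase_cons_head, haux _ rfl]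
    · have hcW : c ∈ W := (Multiset.mem_cons.1 hc).resolve_left hcy
      obtain ⟨V, rfl⟩ := Multiset.exists_cons_of_mem hcW
      rw [Multiset.erase_cons_tail_of_mem hcW, Multiset.erase_cons_head, haux _ (by simp)]
      exact hsw V y c (by simp)
  rw [blockOp, Multiset.card_cons, blockAux, dif_pos hY, key _ hY.choose_spec, Multiset.map_cons,
    Multiset.sum_cons, Multiset.erase_cons_head, haux _ rfl, ← sub_sub]
  congr 2
  refine Multiset.map_congr rfl fun w hw => ?_
  rw [Multiset.erase_cons_tail_of_mem hw, haux]
  rw [Multiset.card_cons, Multiset.card_erase_add_one hw]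

theorem multiset_sum_end_apply (s : Multiset (Module.End K E)) (a : E) :
    s.sum a = (s.map fun t => t a).sum :=
  map_multiset_sum (LinearMap.applyₗ (R := K) a : Module.End K E →ₗ[K] E) s

/-- In the model, `blockOp μ x {y₁, …, yₖ} z` is `x^(k+1) y₁ ⋯ yₖ z`, which is symmetric in
`y₁, …, yₖ, z`. -/
theorem blockOp_swap (h : IsNovikov μ) (x : E) (W : Multiset E) (y z : E) :
    blockOp μ x (y ::ₘ W) z = blockOp μ x (z ::ₘ W) y := by
  classical
  induction hn : Multiset.card W using Nat.strong_induction_on generalizing W y z with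
  | _ n ih =>
    have hsw : ∀ (V : Multiset E) (a b : E), Multiset.card V + 1 = Multiset.card W →
        blockOp μ x (a ::ₘ V) b = blockOp μ x (b ::ₘ V) a := fun V a b hV =>
      ih _ (by omega) V a b rfl
    rw [blockAux_cons_of_swap x y W hsw, blockAux_cons_of_swap x z W hsw]
    simp only [LinearMap.sub_apply, multiset_sum_end_apply, Multiset.map_map, Function.comp_def,
      Module.End.mul_apply, rmul_apply]
    rw [h.defect_symm (blockOp_mem x W) z y]
    congr 2
    refine Multiset.map_congr rfl fun w hw => ?_
    rw [h.apply_mul (blockOp_mem _ _), h.apply_mul (blockOp_mem _ _)]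
    rw [hsw _ y z (Multiset.card_erase_add_one hw)]

open Classical in
theorem blockOp_cons (h : IsNovikov μ) (x y : E) (W : Multiset E) :
    blockOp μ x (y ::ₘ W) = rmul μ (blockOp μ x W y) - blockOp μ x W * rmul μ y
      - (W.map fun w => blockOp μ x (y ::ₘ W.erase w) * rmul μ w).sum :=
  blockAux_cons_of_swap x y W fun V a b _ => h.blockOp_swap x V a b

/-- Two blocks may exchange one of their zero-order letters. -/
theorem blockOp_blockOp_swap (h : IsNovikov μ) (x w : E) (Y Z : Multiset E) (y z a : E) :
    blockOp μ x (y ::ₘ Y) (blockOp μ w (z ::ₘ Z) a) =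
      blockOp μ x (z ::ₘ Y) (blockOp μ w (y ::ₘ Z) a) := by
  have hM := blockOp_mem (μ := μ)
  rw [h.blockOp_swap w Z z a, h.comm_of_mem (hM _ _) (hM _ _), h.blockOp_swap x Y y z,
    h.comm_of_mem (hM _ _) (hM _ _), h.blockOp_swap w Z a y]

/-! ### Normal words -/

/-- The element that in the model is the monomial
`x₁^(k₁+1) ⋯ xᵣ^(kᵣ+1) y₁ ⋯ yₘ` with `m = k₁ + ⋯ + kᵣ + 1`, for `L = [(x₁, k₁), …, (xᵣ, kᵣ)]` and
`l = [y₁, …, yₘ]`: the first `k₁` of the zero-order letters join the block of `x₁`, the next `k₂`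
that of `x₂`, and so on, and the last one is what the blocks act on. Lists `l` of any other length
give meaningless values. -/
noncomputable def wordVal (μ : E →ₗ[K] E →ₗ[K] E) : List (E × ℕ) → List E → E
  | [], l => l.headD 0
  | (x, k) :: L, l => blockOp μ x (l.take k) (wordVal μ L (l.drop k))

/-- The number of zero-order letters needed by the letters `L` to form a monomial of weight
`-1`. -/
def numZero {Y : Type*} (L : List (Y × ℕ)) : ℕ := (L.map Prod.snd).sum + 1

theorem numZero_cons {Y : Type*} (x : Y × ℕ) (L : List (Y × ℕ)) :
    numZero (x :: L) = x.2 + numZero L := by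
  simp [numZero, add_assoc]

theorem blockOp_wordVal_swap (h : IsNovikov μ) (x : E) (Y : Multiset E) (y z : E)
    (L : List (E × ℕ)) (l : List E) (hl : (z :: l).length = numZero L) :
    blockOp μ x (y ::ₘ Y) (wordVal μ L (z :: l)) =
      blockOp μ x (z ::ₘ Y) (wordVal μ L (y :: l)) := by
  induction L with
  | nil => exact h.blockOp_swap x Y y z
  | cons w L ih =>
    obtain ⟨w, k⟩ := w
    cases k with
    | zero =>
      have hM := blockOp_mem (μ := μ)
      simp only [wordVal, List.take_zero, List.drop_zero]
      rw [h.comm_of_mem (hM _ _) (hM _ _), ih (by simpa [numZero_cons] using hl),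
        h.comm_of_mem (hM _ _) (hM _ _)]
    | succ k =>
      simp only [wordVal, List.take_succ_cons, List.drop_succ_cons, ← Multiset.cons_coe]
      exact h.blockOp_blockOp_swap _ _ _ _ _ _ _

/-- Adjacent zero-order letters may be exchanged: within a block since its letters form a multiset,
and across the end of a block by `blockOp_wordVal_swap`. -/
theorem wordVal_perm_right (h : IsNovikov μ) (L : List (E × ℕ)) {l l' : List E}
    (hp : l.Perm l') (hl : l.length = numZero L) : wordVal μ L l = wordVal μ L l' := by
  induction L generalizing l l' with
  | nil =>
    obtain ⟨y, rfl⟩ := List.length_eq_one_iff.1 hl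
    rw [List.singleton_perm.1 hp]
  | cons x L ih =>
    obtain ⟨x, k⟩ := x
    have key : ∀ p : List E, (p ++ l).length = numZero ((x, k) :: L) →
        wordVal μ ((x, k) :: L) (p ++ l) = wordVal μ ((x, k) :: L) (p ++ l') := by
      clear hl
      induction hp with
      | nil => intro p _; rfl
      | cons a _ ihp =>
        intro p hpl
        have := ihp (p ++ [a]) (by simpa using hpl)
        simpa using this
      | swap a b t =>
        intro p hpl
        rw [numZero_cons] at hpl
        simp only [List.length_append, List.length_cons] at hpl
        simp only [wordVal]
        rcases le_or_gt k p.length with hk | hk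
        · rw [List.take_append_of_le_length hk, List.take_append_of_le_length hk,
            List.drop_append_of_le_length hk, List.drop_append_of_le_length hk]
          rw [ih ((List.Perm.swap a b t).append_left _)]
          simp only [List.length_append, List.length_cons, List.length_drop]
          omega
        · obtain ⟨j, rfl⟩ := Nat.exists_eq_add_of_lt hk
          rw [add_assoc, List.take_length_add_append, List.take_length_add_append,
            List.drop_length_add_append, List.drop_length_add_append]
          cases j with
          | zero =>
            simp only [zero_add, List.take_succ_cons, List.take_zero, List.drop_succ_cons,
              List.drop_zero]
            rw [← Multiset.coe_add, ← Multiset.coe_add, Multiset.coe_singleton,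
              Multiset.coe_singleton, add_comm, add_comm (p : Multiset E),
              Multiset.singleton_add, Multiset.singleton_add]
            refine h.blockOp_wordVal_swap x p b a L t ?_
            simp only [List.length_cons]
            omega
          | succ j =>
            simp only [List.take_succ_cons, List.drop_succ_cons]
            rw [Multiset.coe_eq_coe.2 ((List.Perm.swap a b (t.take j)).append_left p)]
      | trans h1 _ ih1 ih2 =>
        intro p hpl
        rw [ih1 p hpl, ih2 p (by rw [← hpl, List.length_append, List.length_append, h1.length_eq])]
    exact key [] hl

theorem numZero_perm {Y : Type*} {L L' : List (Y × ℕ)} (hp : L.Perm L') :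
    numZero L = numZero L' := by
  rw [numZero, numZero, (hp.map Prod.snd).sum_eq]

theorem wordVal_perm_left (h : IsNovikov μ) {L L' : List (E × ℕ)} (hp : L.Perm L') (l : List E)
    (hl : l.length = numZero L) : wordVal μ L l = wordVal μ L' l := by
  induction hp generalizing l with
  | nil => rfl
  | cons x _ ih =>
    simp only [wordVal]
    rw [ih]
    rw [numZero_cons] at hl
    rw [List.length_drop]
    omega
  | swap x w L =>
    obtain ⟨x, k⟩ := x
    obtain ⟨w, j⟩ := w
    have hl' := hl
    simp only [numZero_cons] at hl
    obtain ⟨l₁, l', h1, rfl⟩ : ∃ l₁ l', l₁.length = j ∧ l₁ ++ l' = l :=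
      ⟨l.take j, l.drop j, by simp; omega, List.take_append_drop j l⟩
    simp only [List.length_append, h1] at hl
    obtain ⟨l₂, l₃, h2, rfl⟩ : ∃ l₂ l₃, l₂.length = k ∧ l₂ ++ l₃ = l' :=
      ⟨l'.take k, l'.drop k, by simp; omega, List.take_append_drop k l'⟩
    have hr : wordVal μ ((x, k) :: (w, j) :: L) (l₁ ++ (l₂ ++ l₃)) =
        wordVal μ ((x, k) :: (w, j) :: L) (l₂ ++ (l₁ ++ l₃)) := by
      refine h.wordVal_perm_right _ ?_ ?_
      · rw [← List.append_assoc, ← List.append_assoc]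
        exact List.perm_append_comm.append_right l₃
      · rw [hl', numZero_perm (List.Perm.swap _ _ _)]
    rw [hr]
    subst h1 h2
    simp only [wordVal, List.take_left, List.drop_left]
    exact h.comm_of_mem (blockOp_mem _ _) (blockOp_mem _ _) _
  | trans h1 _ ih1 ih2 => rw [ih1 l hl, ih2 l (hl.trans (numZero_perm h1))]

/-! ### Normal words span -/

/-- The algebra generated by the multiplications by blocks with letters in `B`. -/
def blockAlg (μ : E →ₗ[K] E →ₗ[K] E) (B : Set E) : Subalgebra K (Module.End K E) :=
  Algebra.adjoin K {s | ∃ x ∈ B, ∃ Y : Multiset E, (∀ y ∈ Y, y ∈ B) ∧ s = blockOp μ x Y}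

/-- The span of the elements `s y` with `y ∈ B` and `s` a product of multiplications by blocks with
letters in `B`. -/
def wordSpan (μ : E →ₗ[K] E →ₗ[K] E) (B : Set E) : Submodule K E :=
  Submodule.span K {a | ∃ s ∈ blockAlg μ B, ∃ y ∈ B, a = s y}

variable {B : Set E}

theorem blockOp_mem_blockAlg {x : E} (hx : x ∈ B) {Y : Multiset E} (hY : ∀ y ∈ Y, y ∈ B) :
    blockOp μ x Y ∈ blockAlg μ B :=
  Algebra.subset_adjoin ⟨x, hx, Y, hY, rfl⟩

theorem blockAlg_le : blockAlg μ B ≤ rightAlg μ := by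
  refine Algebra.adjoin_le ?_
  rintro _ ⟨x, _, Y, _, rfl⟩
  exact blockOp_mem x Y

theorem rmul_mem_blockAlg {y : E} (hy : y ∈ B) : rmul μ y ∈ blockAlg μ B := by
  rw [← blockOp_zero]
  exact blockOp_mem_blockAlg hy (by simp)

theorem subset_wordSpan : B ⊆ wordSpan μ B := fun y hy =>
  Submodule.subset_span ⟨1, one_mem _, y, hy, rfl⟩

/-- In the model, `(s y)'` for a product `s` of blocks is a combination of products of blocks: the
Leibniz rule reduces this to a single block, where it is the recursion for `blockOp`. -/
theorem rmul_apply_mem_blockAlg (h : IsNovikov μ) {s : Module.End K E} (hs : s ∈ blockAlg μ B)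
    {y : E} (hy : y ∈ B) : rmul μ (s y) ∈ blockAlg μ B := by
  classical
  have hle := blockAlg_le (μ := μ) (B := B)
  have hs' := hs
  unfold blockAlg at hs
  induction hs using Algebra.adjoin_induction with
  | mem s hs =>
    obtain ⟨x, hx, Y, hY, rfl⟩ := hs
    have := h.blockOp_cons x y Y
    rw [sub_sub, eq_sub_iff_add_eq] at this
    rw [← this]
    refine add_mem (blockOp_mem_blockAlg hx ?_) (add_mem (mul_mem hs' (rmul_mem_blockAlg hy))
      (multiset_sum_mem _ fun s hs => ?_))
    · simpa [hy] using hY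
    · obtain ⟨z, hz, rfl⟩ := Multiset.mem_map.1 hs
      refine mul_mem (blockOp_mem_blockAlg hx ?_) (rmul_mem_blockAlg (hY z hz))
      intro w hw
      rcases Multiset.mem_cons.1 hw with rfl | hw
      · exact hy
      · exact hY w (Multiset.mem_of_mem_erase hw)
  | algebraMap r =>
    rw [Module.algebraMap_end_apply, rmul, map_smul]
    exact Subalgebra.smul_mem _ (rmul_mem_blockAlg hy) r
  | add s t hs ht ihs iht =>
    rw [LinearMap.add_apply, rmul, map_add]
    exact add_mem (ihs hs) (iht ht)
  | mul s t hs ht ihs iht =>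
    have : rmul μ ((s * t) y) = t * rmul μ (s y) + s * rmul μ (t y) - s * t * rmul μ y := by
      ext a
      have := h.defect_mul (hle hs) (hle ht) a y
      have hc := h.comm_of_mem (hle hs) (hle ht) (μ a y)
      rw [sub_eq_iff_eq_add] at this
      simp only [rmul_apply, Module.End.mul_apply, LinearMap.sub_apply, LinearMap.add_apply, this,
        map_sub, hc]
      abel
    rw [this]
    exact sub_mem (add_mem (mul_mem ht (ihs hs)) (mul_mem hs (iht ht)))
      (mul_mem (mul_mem hs ht) (rmul_mem_blockAlg hy))

theorem mul_mem_wordSpan (h : IsNovikov μ) {a b : E} (ha : a ∈ wordSpan μ B)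
    (hb : b ∈ wordSpan μ B) : μ a b ∈ wordSpan μ B := by
  have hR : rmul μ b ∈ blockAlg μ B := by
    induction hb using Submodule.span_induction with
    | mem b hb =>
      obtain ⟨s, hs, y, hy, rfl⟩ := hb
      exact h.rmul_apply_mem_blockAlg hs hy
    | zero => rw [rmul, map_zero]; exact zero_mem _
    | add b c _ _ hb hc => rw [rmul, map_add]; exact add_mem hb hc
    | smul r b _ hb => rw [rmul, map_smul]; exact Subalgebra.smul_mem _ hb r
  change rmul μ b a ∈ _
  have : wordSpan μ B ≤ (wordSpan μ B).comap (rmul μ b) := by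
    refine Submodule.span_le.2 ?_
    rintro _ ⟨s, hs, y, hy, rfl⟩
    exact Submodule.subset_span ⟨_, mul_mem hR hs, y, hy, rfl⟩
  exact this ha

theorem wordSpan_le {X : Type*} (f : X → E) : wordSpan μ (Set.range f) ≤ Submodule.span K
    {a | ∃ (L : List (X × ℕ)) (l : List X), l.length = numZero L ∧
      a = wordVal μ (L.map fun z => (f z.1, z.2)) (l.map f)} := by
  refine Submodule.span_le.2 ?_
  rintro _ ⟨s, hs, _, ⟨y, rfl⟩, rfl⟩
  have hs' : s ∈ Subalgebra.toSubmodule (blockAlg μ (Set.range f)) := hs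
  rw [blockAlg, Algebra.adjoin_eq_span] at hs'
  clear hs
  induction hs' using Submodule.span_induction with
  | mem s hs =>
    refine Submodule.subset_span ?_
    induction hs using Submonoid.closure_induction_left with
    | one => exact ⟨[], [y], rfl, rfl⟩
    | mul_left s hs t _ ih =>
      obtain ⟨_, ⟨x, rfl⟩, Y, hY, rfl⟩ := hs
      obtain ⟨L, l, hl, he⟩ := ih
      obtain ⟨V, rfl⟩ : ∃ V : List X, ((V.map f : List E) : Multiset E) = Y := by
        induction Y using Quotient.inductionOn with
        | h Y =>
          obtain ⟨V, rfl⟩ : Y ∈ Set.range (List.map f) := by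
            rw [Set.range_list_map]
            exact fun y hy => hY y hy
          exact ⟨V, rfl⟩
      refine ⟨(x, V.length) :: L, V ++ l, ?_, ?_⟩
      · rw [numZero_cons, List.length_append, hl]
      · have hV : V.length = (V.map f).length := by simp
        rw [Module.End.mul_apply, he, List.map_cons, List.map_append, wordVal]
        simp only [hV, List.take_left, List.drop_left]
  | zero => simp
  | add s t _ _ hs ht => exact add_mem hs ht
  | smul r s _ hs => exact Submodule.smul_mem _ r hs

end IsNovikov

/-! ### The polynomial model -/

theorem Derivation.map_multiset_prod {R A ι : Type*} [CommRing R] [CommRing A] [Algebra R A]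
    [DecidableEq ι] (D : Derivation R A A) (g : ι → A) (Y : Multiset ι) :
    D (Y.map g).prod = (Y.map fun y => ((Y.erase y).map g).prod * D (g y)).sum := by
  induction Y using Multiset.induction_on with
  | empty => simp
  | cons a s ih =>
    have : (s.map fun y => (((a ::ₘ s).erase y).map g).prod * D (g y)) =
        s.map fun y => g a * (((s.erase y).map g).prod * D (g y)) := by
      refine Multiset.map_congr rfl fun y hy => ?_
      rw [Multiset.erase_cons_tail_of_mem hy, Multiset.map_cons, Multiset.prod_cons, mul_assoc]
    rw [Multiset.map_cons, Multiset.prod_cons, Derivation.leibniz, ih, Multiset.map_cons,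
      Multiset.sum_cons, this, Multiset.sum_map_mul_left, Multiset.erase_cons_head]
    simp only [smul_eq_mul]
    ring

namespace IsNovikov

variable {K E : Type*} [Field K] [AddCommGroup E] [Module K E] {μ : E →ₗ[K] E →ₗ[K] E}

/-- A homomorphism to a commutative differential algebra takes `blockOp` to the multiplication that it
stands for. -/
theorem map_blockOp (h : IsNovikov μ) {P : Type*} [CommRing P] [Algebra K P]
    (D : Derivation K P P) (φ : E →ₗ[K] P) (hφ : ∀ a b, φ (μ a b) = φ a * D (φ b)) (x : E)
    (Y : Multiset E) (a : E) :
    φ (blockOp μ x Y a) = D^[Multiset.card Y + 1] (φ x) * (Y.map φ).prod * φ a := by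
  classical
  induction hn : Multiset.card Y generalizing Y a with
  | zero =>
    rw [Multiset.card_eq_zero.1 hn]
    simp [blockOp_zero, hφ, mul_comm]
  | succ n ih =>
    obtain ⟨y, hy⟩ := Multiset.card_pos_iff_exists_mem.1 (by omega : 0 < Multiset.card Y)
    obtain ⟨W, rfl⟩ := Multiset.exists_cons_of_mem hy
    have hW : Multiset.card W = n := by simpa using hn
    rw [h.blockOp_cons]
    simp only [LinearMap.sub_apply, multiset_sum_end_apply, Multiset.map_map, Function.comp_def,
      Module.End.mul_apply, rmul_apply, map_sub, hφ, map_multiset_sum]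
    have : (W.map fun w => φ (blockOp μ x (y ::ₘ W.erase w) (μ a w))) =
        W.map fun w => D^[n + 1] (φ x) * φ y * φ a * (((W.erase w).map φ).prod * D (φ w)) := by
      refine Multiset.map_congr rfl fun w hw => ?_
      rw [ih _ _ (by rw [Multiset.card_cons, Multiset.card_erase_add_one hw, hW]),
        Multiset.map_cons, Multiset.prod_cons, hφ]
      ring
    rw [this, Multiset.sum_map_mul_left, ih W y hW, ih W _ hW, hφ, Derivation.leibniz,
      Derivation.leibniz, ← Function.iterate_succ_apply' D, D.map_multiset_prod, Multiset.map_cons,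
      Multiset.prod_cons]
    simp only [smul_eq_mul]
    ring

theorem iterate_polyD_X {X : Type*} (y : X × ℕ) (k : ℕ) :
    (DerPerm.polyD K X)^[k] (MvPolynomial.X y) = MvPolynomial.X (y.1, y.2 + k) := by
  induction k with
  | zero => rfl
  | succ k ih =>
    rw [Function.iterate_succ_apply', ih]
    exact MvPolynomial.mkDerivation_X K _ _

variable {X : Type*}

/-- The letters of the monomial that `wordVal` stands for. -/
def wordLetters (L : List (X × ℕ)) (l : List X) : Multiset (X × ℕ) :=
  ((L.map fun z => (z.1, z.2 + 1)) ++ l.map fun x => (x, 0) : List (X × ℕ))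

theorem map_wordVal (h : IsNovikov μ) (φ : E →ₗ[K] MvPolynomial (X × ℕ) K)
    (hφ : ∀ a b, φ (μ a b) = φ a * DerPerm.polyD K X (φ b)) (f : X → E)
    (hf : ∀ x, φ (f x) = MvPolynomial.X (x, 0)) (L : List (X × ℕ)) (l : List X)
    (hl : l.length = numZero L) :
    φ (wordVal μ (L.map fun z => (f z.1, z.2)) (l.map f)) =
      ((wordLetters L l).map MvPolynomial.X).prod := by
  have hl0 : ∀ l : List X, ((l.map f : Multiset E).map φ).prod =
      ((l.map fun x => (x, 0)).map (MvPolynomial.X (R := K))).prod := by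
    intro l
    rw [Multiset.map_coe, Multiset.prod_coe, List.map_map, List.map_map]
    congr 1
    exact List.map_congr_left fun x _ => hf x
  induction L generalizing l with
  | nil =>
    obtain ⟨y, rfl⟩ := List.length_eq_one_iff.1 hl
    simp [wordVal, wordLetters, hf]
  | cons z L ih =>
    obtain ⟨x, k⟩ := z
    rw [numZero_cons] at hl
    have ih' := ih (l.drop k) (by rw [List.length_drop]; omega)
    have hk : Multiset.card ((l.take k).map f : Multiset E) = k := by
      rw [Multiset.coe_card, List.length_map, List.length_take]
      omega
    rw [List.map_cons, wordVal, ← List.map_take, ← List.map_drop,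
      h.map_blockOp (DerPerm.polyD K X) φ hφ, hf, iterate_polyD_X, hk, ih', hl0]
    conv_rhs => rw [← List.take_append_drop k l]
    simp only [wordLetters, List.map_cons, List.map_append, List.cons_append, Multiset.map_coe,
      Multiset.prod_coe, List.prod_cons, List.prod_append, zero_add]
    ring

theorem prod_map_X_eq {σ : Type*} [DecidableEq σ] (m : Multiset σ) :
    (m.map (MvPolynomial.X (R := K))).prod = MvPolynomial.monomial (Multiset.toFinsupp m) 1 := by
  induction m using Multiset.induction_on with
  | empty => simp
  | cons a s ih =>
    rw [Multiset.map_cons, Multiset.prod_cons, ih, MvPolynomial.X, MvPolynomial.monomial_mul,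
      one_mul, ← Multiset.singleton_add, Multiset.toFinsupp_add, Multiset.toFinsupp_singleton]

theorem wordLetters_inj {L L' : List (X × ℕ)} {l l' : List X}
    (h : wordLetters L l = wordLetters L' l') : L.Perm L' ∧ l.Perm l' := by
  have h1 : ∀ (L : List (X × ℕ)) (l : List X),
      (wordLetters L l).filterMap (fun z => if z.2 = 0 then some z.1 else none) = l := by
    intro L l
    simp [wordLetters, List.filterMap_append, List.filterMap_map]
  have h2 : ∀ (L : List (X × ℕ)) (l : List X),
      (wordLetters L l).filterMap (fun z => if z.2 = 0 then none else some (z.1, z.2 - 1)) = L := by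
    intro L l
    simp [wordLetters, List.filterMap_append, List.filterMap_map]
  exact ⟨Multiset.coe_eq_coe.1 (by rw [← h2 L l, h, h2]),
    Multiset.coe_eq_coe.1 (by rw [← h1 L l, h, h1])⟩

/-- A linear map that sends a set injectively into a linearly independent set is injective on the
span of that set. -/
theorem eq_zero_of_mem_span {M N ι : Type*} [AddCommGroup M] [Module K M] [AddCommGroup N]
    [Module K N] (φ : M →ₗ[K] N) {v : ι → N} (hv : LinearIndependent K v) {S : Set M} (g : S → ι)
    (hg : Function.Injective g) (hφ : ∀ a : S, φ a = v (g a)) {a : M}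
    (ha : a ∈ Submodule.span K S) (h0 : φ a = 0) : a = 0 := by
  rw [← Subtype.range_coe (s := S), Finsupp.mem_span_range_iff_exists_finsupp] at ha
  obtain ⟨c, rfl⟩ := ha
  have : c = 0 := by
    refine linearIndependent_iff.1 (hv.comp g hg) c ?_
    rw [← h0, map_finsuppSum, Finsupp.linearCombination_apply]
    exact Finsupp.sum_congr fun i _ => by rw [map_smul, hφ, Function.comp_apply]
  rw [this, Finsupp.sum_zero_index]

/-- In a Novikov algebra with a homomorphism `φ` to the polynomial model that takes a set of elements
bijectively to the generators, `φ` is injective on the subalgebra that they generate: normal words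
span the latter, and a normal word is determined by its monomial. -/
theorem eq_zero_of_map_eq_zero (h : IsNovikov μ) (φ : E →ₗ[K] MvPolynomial (X × ℕ) K)
    (hφ : ∀ a b, φ (μ a b) = φ a * DerPerm.polyD K X (φ b)) (f : X → E)
    (hf : ∀ x, φ (f x) = MvPolynomial.X (x, 0)) {a : E} (ha : a ∈ wordSpan μ (Set.range f))
    (h0 : φ a = 0) : a = 0 := by
  classical
  have ha := wordSpan_le f ha
  set S : Set E := {a | ∃ (L : List (X × ℕ)) (l : List X), l.length = numZero L ∧
      a = wordVal μ (L.map fun z => (f z.1, z.2)) (l.map f)}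
  choose L l hl he using fun a : S => a.2
  have hm : ∀ a : S, φ a = MvPolynomial.basisMonomials (X × ℕ) K
      (Multiset.toFinsupp (wordLetters (L a) (l a))) := fun a => by
    rw [MvPolynomial.coe_basisMonomials]
    dsimp only
    rw [← prod_map_X_eq, ← h.map_wordVal φ hφ f hf _ _ (hl a), ← he a]
  refine eq_zero_of_mem_span φ (MvPolynomial.basisMonomials (X × ℕ) K).linearIndependent
    (fun a : S => Multiset.toFinsupp (wordLetters (L a) (l a))) ?_ hm ha h0
  intro a b hab
  obtain ⟨h1, h2⟩ := wordLetters_inj (Multiset.toFinsupp.injective hab)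
  have hn : ∀ L : List (X × ℕ), numZero (L.map fun z => (f z.1, z.2)) = numZero L := fun L => by
    simp [numZero, Function.comp_def]
  ext
  rw [he a, he b, h.wordVal_perm_right _ (h2.map f) (by rw [List.length_map, hl, hn]),
    h.wordVal_perm_left (h1.map _) _
      (by rw [List.length_map, ← h2.length_eq, hl, hn])]

end IsNovikov

/-! ### From dialgebras to algebras -/

namespace IsNovikovDialgebra

variable {K A : Type*} [Field K] [AddCommGroup A] [Module K A] {vd dv : A →ₗ[K] A →ₗ[K] A}

/-- The elements that act by zero, `i` with `a ⊣ i = 0` and `i ⊢ a = 0` for all `a`. In a Novikov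
dialgebra they form an ideal that contains all `a ⊣ b - a ⊢ b`. -/
def annihilator (vd dv : A →ₗ[K] A →ₗ[K] A) : Submodule K A :=
  LinearMap.ker dv.flip ⊓ LinearMap.ker vd

theorem mem_annihilator {i : A} :
    i ∈ annihilator vd dv ↔ (∀ a, dv a i = 0) ∧ ∀ a, vd i a = 0 := by
  simp [annihilator, LinearMap.ext_iff]

theorem sub_mem_annihilator (h : IsNovikovDialgebra vd dv) (a b : A) :
    dv a b - vd a b ∈ annihilator vd dv := by
  refine mem_annihilator.2 ⟨fun c => ?_, fun c => ?_⟩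
  · rw [map_sub, h.zero_right, sub_self]
  · rw [map_sub, LinearMap.sub_apply, h.zero_left, sub_self]

theorem annihilator_le_comap (h : IsNovikovDialgebra vd dv) (a : A) :
    annihilator vd dv ≤ (annihilator vd dv).comap (vd a) := by
  intro i hi
  obtain ⟨h1, h2⟩ := mem_annihilator.1 hi
  refine mem_annihilator.2 ⟨fun c => ?_, fun c => ?_⟩
  · rw [h.zero_right, h1, map_zero]
  · rw [← h.rcom_mixed, h1]

theorem annihilator_le_comap_flip (a : A) :
    annihilator vd dv ≤ (annihilator vd dv).comap (vd.flip a) := by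
  intro i hi
  rw [Submodule.mem_comap, LinearMap.flip_apply, (mem_annihilator.1 hi).2]
  exact zero_mem _

/-- The split null extension of the Novikov algebra `A ⧸ annihilator` by the bimodule `A`, on which
the quotient acts by `⊢` from the left and by `⊣` from the right. -/
def splitOp (h : IsNovikovDialgebra vd dv) :
    ((A ⧸ annihilator vd dv) × A) →ₗ[K] ((A ⧸ annihilator vd dv) × A) →ₗ[K]
      ((A ⧸ annihilator vd dv) × A) :=
  LinearMap.mk₂ K
    (fun p q => (quotOp _ vd h.annihilator_le_comap annihilator_le_comap_flip p.1 q.1,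
      (annihilator vd dv).liftQ vd inf_le_right p.1 q.2
        + (annihilator vd dv).liftQ dv.flip inf_le_left q.1 p.2))
    (fun p p' q => by ext <;> simp; abel)
    (fun r p q => by ext <;> simp)
    (fun p q q' => by ext <;> simp; abel)
    (fun r p q => by ext <;> simp)

theorem splitOp_mk (h : IsNovikovDialgebra vd dv) (a b m n : A) :
    h.splitOp ((annihilator vd dv).mkQ a, m) ((annihilator vd dv).mkQ b, n) =
      ((annihilator vd dv).mkQ (vd a b), vd a n + dv m b) := rfl

theorem mkQ_dv (h : IsNovikovDialgebra vd dv) (a b : A) :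
    (annihilator vd dv).mkQ (dv a b) = (annihilator vd dv).mkQ (vd a b) := by
  rw [← sub_eq_zero, ← map_sub]
  exact (Submodule.Quotient.mk_eq_zero _).2 (h.sub_mem_annihilator a b)

theorem isNovikov_splitOp (h : IsNovikovDialgebra vd dv) : IsNovikov h.splitOp := by
  constructor <;> rintro ⟨a, m⟩ ⟨b, n⟩ ⟨c, p⟩ <;>
    obtain ⟨a, rfl⟩ := Submodule.mkQ_surjective _ a <;>
    obtain ⟨b, rfl⟩ := Submodule.mkQ_surjective _ b <;>
    obtain ⟨c, rfl⟩ := Submodule.mkQ_surjective _ c <;>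
    simp only [splitOp_mk, Prod.mk_sub_mk, ← map_sub, map_add, LinearMap.add_apply]
  · refine Prod.ext (by rw [h.lsym]) ?_
    have h1 := h.lsym a b p
    have h2 := h.lsym_mixed m b c
    have h3 := h.lsym_mixed n a c
    rw [← h.zero_right] at h2 h3
    rw [sub_eq_iff_eq_add] at h1 h2 h3
    simp only [h1, h2, h3]
    abel
  · refine Prod.ext ?_ ?_
    · rw [← h.rcom_mixed, h.mkQ_dv]
    · rw [← h.rcom_mixed a p b, h.rcom_mixed a n c, h.rcom m b c]
      simp only [h.rcom_mixed]
      abel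

end IsNovikovDialgebra

/-- The operation `u v'` on a commutative algebra with a derivation. -/
def derivOp {K P : Type*} [Field K] [CommRing P] [Algebra K P] (D : Derivation K P P) :
    P →ₗ[K] P →ₗ[K] P :=
  (LinearMap.mul K P).compl₂ (D : P →ₗ[K] P)

theorem isNovikov_derivOp {K P : Type*} [Field K] [CommRing P] [Algebra K P]
    (D : Derivation K P P) : IsNovikov (derivOp D) := by
  constructor <;> intro a b c <;>
    simp only [derivOp, LinearMap.compl₂_apply, LinearMap.mul_apply', Derivation.coeFn_coe,
      Derivation.leibniz, smul_eq_mul] <;> ring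

/-- The componentwise operation on a product. -/
def prodOp {K E F : Type*} [Field K] [AddCommGroup E] [Module K E] [AddCommGroup F] [Module K F]
    (μ : E →ₗ[K] E →ₗ[K] E) (ν : F →ₗ[K] F →ₗ[K] F) : (E × F) →ₗ[K] (E × F) →ₗ[K] (E × F) :=
  LinearMap.mk₂ K (fun p q => (μ p.1 q.1, ν p.2 q.2))
    (fun p p' q => by simp) (fun r p q => by simp) (fun p q q' => by simp) (fun r p q => by simp)

theorem prodOp_mk {K E F : Type*} [Field K] [AddCommGroup E] [Module K E] [AddCommGroup F]
    [Module K F] (μ : E →ₗ[K] E →ₗ[K] E) (ν : F →ₗ[K] F →ₗ[K] F) (a b : E) (m n : F) :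
    prodOp μ ν (a, m) (b, n) = (μ a b, ν m n) := rfl

theorem IsNovikov.prod {K E F : Type*} [Field K] [AddCommGroup E] [Module K E] [AddCommGroup F]
    [Module K F] {μ : E →ₗ[K] E →ₗ[K] E} {ν : F →ₗ[K] F →ₗ[K] F} (hμ : IsNovikov μ)
    (hν : IsNovikov ν) : IsNovikov (prodOp μ ν) := by
  constructor <;> rintro ⟨a, m⟩ ⟨b, n⟩ ⟨c, p⟩ <;> simp only [prodOp_mk, Prod.mk_sub_mk]
  · rw [hμ.lsym, hν.lsym]
  · rw [hμ.rcom, hν.rcom]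

/-- The free Novikov dialgebra is generated by `X`. -/
theorem DiNov.eq_top_of_closed {K X : Type*} [Field K] (N : Submodule K (DiNov K X))
    (hof : ∀ x, DiNov.of K x ∈ N) (hvd : ∀ a ∈ N, ∀ b ∈ N, DiNov.vd K X a b ∈ N)
    (hdv : ∀ a ∈ N, ∀ b ∈ N, DiNov.dv K X a b ∈ N) : N = ⊤ := by
  have hw : ∀ w : DiWord X, (FreeDi.novIdeal K X).mkQ (Finsupp.single w 1) ∈ N := by
    intro w
    induction w with
    | of x => exact hof x
    | vd u v hu hv =>
      convert hvd _ hu _ hv using 1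
      change _ = (FreeDi.novIdeal K X).mkQ (FreeDi.vd K X _ _)
      simp [FreeDi.vd, Finsupp.lmapDomain_apply, Finsupp.mapDomain_single]
    | dv u v hu hv =>
      convert hdv _ hu _ hv using 1
      change _ = (FreeDi.novIdeal K X).mkQ (FreeDi.dv K X _ _)
      simp [FreeDi.dv, Finsupp.lmapDomain_apply, Finsupp.mapDomain_single]
  refine Submodule.eq_top_iff'.2 fun a => ?_
  obtain ⟨a, rfl⟩ := Submodule.mkQ_surjective _ a
  induction a using Finsupp.induction_linear with
  | zero => rw [map_zero]; exact zero_mem _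
  | add a b ha hb => rw [map_add]; exact add_mem ha hb
  | single w r =>
    rw [← mul_one r, ← smul_eq_mul, ← Finsupp.smul_single, map_smul]
    exact N.smul_mem r (hw w)

/-! ### Injectivity of the canonical homomorphism -/

namespace DerPerm

variable (K X : Type*) [Field K]

/-- The inclusion of the polynomials in the letters `x^(k)` into those in two copies of the
letters. -/
noncomputable def inlPoly : MvPolynomial (X × ℕ) K →ₐ[K] MvPolynomial ((X ⊕ X) × ℕ) K :=
  MvPolynomial.rename (Prod.map Sum.inl id)

/-- The map that marks the last letter of a monomial: it is taken from a second copy of the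
alphabet, and the product is commutative. -/
noncomputable def mark : DerPerm K X →ₗ[K] MvPolynomial ((X ⊕ X) × ℕ) K :=
  Finsupp.lsum K fun y =>
    (LinearMap.mulRight K (MvPolynomial.X (Sum.inr y.1, y.2))).comp (inlPoly K X).toLinearMap

variable {K X}

theorem inlPoly_polyD (p : MvPolynomial (X × ℕ) K) :
    inlPoly K X (polyD K X p) = polyD K (X ⊕ X) (inlPoly K X p) := by
  induction p using MvPolynomial.induction_on with
  | C r => simp [inlPoly, polyD, MvPolynomial.derivation_C]
  | add p q hp hq => simp only [map_add, hp, hq]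
  | mul_X p y hp =>
    simp only [map_mul, Derivation.leibniz, map_add, smul_eq_mul, hp]
    simp [inlPoly, polyD, MvPolynomial.mkDerivation_X]

theorem mark_smul_letter (p : MvPolynomial (X × ℕ) K) (y : X × ℕ) :
    mark K X (p • letter K y) = inlPoly K X p * MvPolynomial.X (Sum.inr y.1, y.2) := by
  rw [← single_eq_smul]
  exact Finsupp.lsum_single (M := MvPolynomial (X × ℕ) K) _ _ y p

theorem mark_smul (p : MvPolynomial (X × ℕ) K) (u : DerPerm K X) :
    mark K X (p • u) = inlPoly K X p * mark K X u := by
  induction u using induction_on with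
  | h0 => simp
  | hadd u v hu hv => simp only [smul_add, map_add, hu, hv, mul_add]
  | hs q y => rw [← mul_smul, mark_smul_letter, mark_smul_letter, map_mul, mul_assoc]

theorem mark_d (u : DerPerm K X) : mark K X (d K X u) = polyD K (X ⊕ X) (mark K X u) := by
  induction u using induction_on with
  | h0 => simp
  | hadd u v hu hv => simp only [map_add, hu, hv]
  | hs p y =>
    rw [d_smul_letter, map_add, mark_smul_letter, mark_smul_letter, mark_smul_letter,
      inlPoly_polyD, Derivation.leibniz]
    simp [polyD, MvPolynomial.mkDerivation_X]
    ring

theorem mark_of (x : X) : mark K X (of K x) = MvPolynomial.X (Sum.inr x, 0) := by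
  have := mark_smul_letter (K := K) 1 (x, 0)
  rw [one_smul, map_one, one_mul] at this
  exact this

theorem toPoly_mul (u v : DerPerm K X) : toPoly K X (u * v) = toPoly K X u * toPoly K X v := by
  rw [mul_def, map_smul, smul_eq_mul]

end DerPerm

namespace DiNov

open DerPerm

variable {K X : Type*} [Field K]

theorem toDerPerm_of (x : X) : toDerPerm K X (of K x) = DerPerm.of K x := lift_of _ _ x

theorem toDerPerm_vd (a b : DiNov K X) :
    toDerPerm K X (vd K X a b) = toDerPerm K X a * d K X (toDerPerm K X b) := lift_vd _ _ a b

theorem toDerPerm_dv (a b : DiNov K X) :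
    toDerPerm K X (dv K X a b) = d K X (toDerPerm K X b) * toDerPerm K X a := lift_dv _ _ a b

variable (K X) in
/-- The canonical homomorphism is injective: the elements `(mark (ι u), (0, u))` lie in the
subalgebra generated by two copies of `X` in the product of the polynomial model with the split null
extension, and there an element is determined by its first component. -/
theorem toDerPerm_injective : Function.Injective (toDerPerm K X) := by
  have hA := DiNov.isNovikovDialgebra K X
  set I := IsNovikovDialgebra.annihilator (vd K X) (dv K X)
  set D := polyD K (X ⊕ X)
  have hN := (isNovikov_derivOp D).prod hA.isNovikov_splitOp
  set ν := prodOp (derivOp D) hA.splitOp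
  let f : X ⊕ X → MvPolynomial ((X ⊕ X) × ℕ) K × ((DiNov K X ⧸ I) × DiNov K X) := fun x =>
    (MvPolynomial.X (x, 0), x.elim (fun x => (I.mkQ (of K x), 0)) fun x => (0, of K x))
  let G := IsNovikov.wordSpan ν (Set.range f)
  have hmul : ∀ a ∈ G, ∀ b ∈ G, ν a b ∈ G := fun a ha b hb => hN.mul_mem_wordSpan ha hb
  let Λ₁ : DiNov K X →ₗ[K] MvPolynomial ((X ⊕ X) × ℕ) K × ((DiNov K X ⧸ I) × DiNov K X) :=
    ((inlPoly K X).toLinearMap ∘ₗ (toPoly K X).restrictScalars K ∘ₗ toDerPerm K X).prod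
      (I.mkQ.prod 0)
  let Λ₂ : DiNov K X →ₗ[K] MvPolynomial ((X ⊕ X) × ℕ) K × ((DiNov K X ⧸ I) × DiNov K X) :=
    (mark K X ∘ₗ toDerPerm K X).prod (LinearMap.prod 0 LinearMap.id)
  have h₁ : ∀ u, Λ₁ u = (inlPoly K X (toPoly K X (toDerPerm K X u)), (I.mkQ u, 0)) := fun _ => rfl
  have h₂ : ∀ u, Λ₂ u = (mark K X (toDerPerm K X u), (I.mkQ 0, u)) := fun _ => by
    rw [map_zero]; rfl
  have hν' : ∀ p q a b m n, ν (p, (I.mkQ a, m)) (q, (I.mkQ b, n)) =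
      (p * D q, (I.mkQ (vd K X a b), vd K X a n + dv K X m b)) := fun _ _ _ _ _ _ => rfl
  have hdv : ∀ a b, I.mkQ (dv K X a b) = I.mkQ (vd K X a b) := hA.mkQ_dv
  have h11v : ∀ u v, Λ₁ (vd K X u v) = ν (Λ₁ u) (Λ₁ v) := fun u v => by
    rw [h₁, h₁, h₁, hν', toDerPerm_vd, toPoly_mul, toPoly_d, map_mul, inlPoly_polyD]
    simp [D]
  have h11d : ∀ u v, Λ₁ (dv K X u v) = ν (Λ₁ u) (Λ₁ v) := fun u v => by
    rw [h₁, h₁, h₁, hν', toDerPerm_dv, toPoly_mul, toPoly_d, map_mul, inlPoly_polyD, hdv, mul_comm]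
    simp [D]
  have h12 : ∀ u v, Λ₂ (vd K X u v) = ν (Λ₁ u) (Λ₂ v) := fun u v => by
    rw [h₁, h₂, h₂, hν', toDerPerm_vd, mul_def, mark_smul, mark_d]
    simp [D]
  have h21 : ∀ u v, Λ₂ (dv K X u v) = ν (Λ₂ u) (Λ₁ v) := fun u v => by
    rw [h₁, h₂, h₂, hν', toDerPerm_dv, mul_def, mark_smul, toPoly_d, inlPoly_polyD, mul_comm]
    simp [D]
  -- the generators lie in `G` through either embedding, and both embeddings respect the products
  have htop : G.comap Λ₁ ⊓ G.comap Λ₂ = ⊤ := by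
    refine DiNov.eq_top_of_closed _ (fun x => ⟨?_, ?_⟩) ?_ ?_
    · refine IsNovikov.subset_wordSpan ⟨Sum.inl x, ?_⟩
      rw [h₁, toDerPerm_of, DerPerm.of, toPoly_letter]
      simp [f, inlPoly]
    · refine IsNovikov.subset_wordSpan ⟨Sum.inr x, ?_⟩
      rw [h₂, toDerPerm_of, mark_of, map_zero]
      rfl
    · rintro a ⟨ha₁, _⟩ b ⟨hb₁, hb₂⟩
      refine ⟨?_, ?_⟩
      · change Λ₁ _ ∈ G
        rw [h11v]
        exact hmul _ ha₁ _ hb₁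
      · change Λ₂ _ ∈ G
        rw [h12]
        exact hmul _ ha₁ _ hb₂
    · rintro a ⟨ha₁, ha₂⟩ b ⟨hb₁, _⟩
      refine ⟨?_, ?_⟩
      · change Λ₁ _ ∈ G
        rw [h11d]
        exact hmul _ ha₁ _ hb₁
      · change Λ₂ _ ∈ G
        rw [h21]
        exact hmul _ ha₂ _ hb₁
  refine (injective_iff_map_eq_zero _).2 fun u hu => ?_
  have hG : Λ₂ u ∈ G := (htop ▸ Submodule.mem_top : u ∈ G.comap Λ₁ ⊓ G.comap Λ₂).2
  have h0 := hN.eq_zero_of_map_eq_zero (LinearMap.fst K _ _) (fun _ _ => rfl) f (fun _ => rfl) hG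
    (by rw [h₂, LinearMap.fst_apply, hu, map_zero])
  exact congrArg (fun p => p.2.2) h0

end DiNov

/-! ### Subspaces generated by a bilinear operation and homomorphisms -/

section Closure

variable {K A B : Type*} [Field K] [AddCommGroup A] [Module K A] [AddCommGroup B] [Module K B]
  {op : A →ₗ[K] A →ₗ[K] A} {op' : B →ₗ[K] B →ₗ[K] B} {S : Set A}

theorem subset_opClosure : S ⊆ opClosure op S := fun _ ha =>
  Submodule.mem_sInf.2 fun _ hN => hN.1 ha

theorem op_mem_opClosure {a b : A} (ha : a ∈ opClosure op S) (hb : b ∈ opClosure op S) :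
    op a b ∈ opClosure op S :=
  Submodule.mem_sInf.2 fun N hN =>
    hN.2 a (Submodule.mem_sInf.1 ha N hN) b (Submodule.mem_sInf.1 hb N hN)

theorem opClosure_le {N : Submodule K A} (hS : S ⊆ N) (hop : ∀ a ∈ N, ∀ b ∈ N, op a b ∈ N) :
    opClosure op S ≤ N :=
  sInf_le ⟨hS, hop⟩

theorem opSquare_le_opClosure : opSquare op (opClosure op S) ≤ opClosure op S := by
  refine Submodule.span_le.2 ?_
  rintro _ ⟨a, ha, b, hb, rfl⟩
  exact op_mem_opClosure ha hb

theorem map_opClosure (φ : A →ₗ[K] B) (hφ : ∀ a b, φ (op a b) = op' (φ a) (φ b)) :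
    (opClosure op S).map φ = opClosure op' (φ '' S) := by
  apply le_antisymm
  · rw [Submodule.map_le_iff_le_comap]
    refine opClosure_le (fun a ha => subset_opClosure ⟨a, ha, rfl⟩) fun a ha b hb => ?_
    rw [Submodule.mem_comap, hφ]
    exact op_mem_opClosure ha hb
  · refine opClosure_le ?_ ?_
    · rintro _ ⟨a, ha, rfl⟩
      exact ⟨a, subset_opClosure ha, rfl⟩
    · rintro _ ⟨a, ha, rfl⟩ _ ⟨b, hb, rfl⟩
      exact ⟨op a b, op_mem_opClosure ha hb, hφ a b⟩

theorem map_opSquare (φ : A →ₗ[K] B) (hφ : ∀ a b, φ (op a b) = op' (φ a) (φ b))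
    (N : Submodule K A) : (opSquare op N).map φ = opSquare op' (N.map φ) := by
  rw [opSquare, opSquare, Submodule.map_span]
  congr 1
  ext c
  constructor
  · rintro ⟨_, ⟨a, ha, b, hb, rfl⟩, rfl⟩
    exact ⟨φ a, ⟨a, ha, rfl⟩, φ b, ⟨b, hb, rfl⟩, hφ a b⟩
  · rintro ⟨_, ⟨a, ha, rfl⟩, _, ⟨b, hb, rfl⟩, rfl⟩
    exact ⟨op a b, ⟨a, ha, b, hb, rfl⟩, hφ a b⟩

end Closure

/-! ### The grading by weight -/

namespace DerPerm

variable {K X : Type*} [Field K]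

/-- The weight of a commutative monomial, given by the multiset of its letters. -/
def polyWeight (m : Multiset (X × ℕ)) : ℤ := (m.map fun z => (z.2 : ℤ) - 1).sum

@[simp] theorem polyWeight_zero : polyWeight (0 : Multiset (X × ℕ)) = 0 := rfl

@[simp] theorem polyWeight_add (m n : Multiset (X × ℕ)) :
    polyWeight (m + n) = polyWeight m + polyWeight n := by
  simp [polyWeight]

@[simp] theorem polyWeight_cons (z : X × ℕ) (m : Multiset (X × ℕ)) :
    polyWeight (z ::ₘ m) = (z.2 : ℤ) - 1 + polyWeight m := by
  simp [polyWeight]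

variable (K X) in
/-- The span of the commutative monomials of weight `w`. -/
noncomputable def polyPart (w : ℤ) : Submodule K (MvPolynomial (X × ℕ) K) :=
  Submodule.span K {p | ∃ m, polyWeight m = w ∧ p = (m.map MvPolynomial.X).prod}

variable (K X) in
/-- The span of the monomials of `DerPerm⟨X⟩` of weight `w` whose last letter `x^(k)` satisfies
`P k`. -/
noncomputable def part (w : ℤ) (P : ℕ → Prop) : Submodule K (DerPerm K X) :=
  Submodule.span K
    {u | ∃ (m : Multiset (X × ℕ)) (y : X × ℕ), polyWeight m + ((y.2 : ℤ) - 1) = w ∧ P y.2 ∧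
      u = (m.map (MvPolynomial.X (R := K))).prod • letter K y}

theorem monomial_eq_smul (l : List (X × ℕ)) (y : X × ℕ) :
    monomial K l y = ((l : Multiset (X × ℕ)).map (MvPolynomial.X (R := K))).prod • letter K y := by
  induction l with
  | nil => simp [monomial]
  | cons z l ih =>
    rw [← Multiset.cons_coe, Multiset.map_cons, Multiset.prod_cons, mul_smul, ← ih,
      ← toPoly_letter, ← mul_def]
    rfl

theorem span_monomial_eq_part (w : ℤ) (P : ℕ → Prop) :
    Submodule.span K {u | ∃ l y, weight l y = w ∧ P y.2 ∧ u = monomial K l y} = part K X w P := by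
  have hw : ∀ (l : List (X × ℕ)) y,
      weight l y = polyWeight (l : Multiset (X × ℕ)) + ((y.2 : ℤ) - 1) := fun l y => by simp [weight, polyWeight]
  rw [part]
  congr 1
  ext u
  constructor
  · rintro ⟨l, y, h, hP, rfl⟩
    exact ⟨l, y, by rw [← h, hw], hP, monomial_eq_smul l y⟩
  · rintro ⟨m, y, h, hP, rfl⟩
    refine ⟨m.toList, y, ?_, hP, ?_⟩
    · rw [hw, Multiset.coe_toList, h]
    · rw [monomial_eq_smul, Multiset.coe_toList]

theorem weightNegOneZero_eq : weightNegOneZero K X = part K X (-1) (· = 0) :=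
  span_monomial_eq_part (-1) (· = 0)

theorem weightNegOnePos_eq : weightNegOnePos K X = part K X (-1) (· ≠ 0) :=
  span_monomial_eq_part (-1) (· ≠ 0)

theorem weightNegOne_eq : weightNegOne K X = part K X (-1) (fun _ => True) := by
  rw [← span_monomial_eq_part]
  simp [weightNegOne]

theorem prod_X_mem_polyPart (m : Multiset (X × ℕ)) :
    (m.map MvPolynomial.X).prod ∈ polyPart K X (polyWeight m) :=
  Submodule.subset_span ⟨m, rfl, rfl⟩

theorem X_mem_polyPart (z : X × ℕ) : MvPolynomial.X z ∈ polyPart K X ((z.2 : ℤ) - 1) := by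
  have := prod_X_mem_polyPart (K := K) (z ::ₘ 0)
  rw [polyWeight_cons] at this
  simpa using this

theorem letter_mem_part {P : ℕ → Prop} (y : X × ℕ) (hy : P y.2) :
    letter K y ∈ part K X ((y.2 : ℤ) - 1) P :=
  Submodule.subset_span ⟨0, y, by simp, hy, by simp⟩

theorem smul_mem_part {a b c : ℤ} (hc : a + b = c) {P : ℕ → Prop}
    {p : MvPolynomial (X × ℕ) K} {u : DerPerm K X} (hp : p ∈ polyPart K X a)
    (hu : u ∈ part K X b P) : p • u ∈ part K X c P := by
  induction hp using Submodule.span_induction with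
  | zero => rw [zero_smul]; exact zero_mem _
  | add p q _ _ hp hq => rw [add_smul]; exact add_mem hp hq
  | smul r p _ hp => rw [smul_assoc]; exact Submodule.smul_mem _ r hp
  | mem p hp =>
    obtain ⟨m, hm, rfl⟩ := hp
    induction hu using Submodule.span_induction with
    | zero => rw [smul_zero]; exact zero_mem _
    | add u v _ _ hu hv => rw [smul_add]; exact add_mem hu hv
    | smul r u _ hu =>
      rw [← algebraMap_smul (MvPolynomial (X × ℕ) K) r u, smul_comm, algebraMap_smul]
      exact Submodule.smul_mem _ r hu
    | mem u hu =>
      obtain ⟨n, y, hn, hy, rfl⟩ := hu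
      refine Submodule.subset_span ⟨m + n, y, ?_, hy, ?_⟩
      · rw [polyWeight_add, hm, add_assoc, hn, hc]
      · rw [Multiset.map_add, Multiset.prod_add, mul_smul]

theorem mul_mem_polyPart {a b c : ℤ} (hc : a + b = c) {p q : MvPolynomial (X × ℕ) K}
    (hp : p ∈ polyPart K X a) (hq : q ∈ polyPart K X b) : p * q ∈ polyPart K X c := by
  have := Submodule.mul_mem_mul hp hq
  rw [polyPart, polyPart, Submodule.span_mul_span] at this
  refine Submodule.span_mono ?_ this
  rintro _ ⟨_, ⟨m, hm, rfl⟩, _, ⟨n, hn, rfl⟩, rfl⟩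
  exact ⟨m + n, by rw [polyWeight_add, hm, hn, hc], by simp⟩

theorem polyD_X (z : X × ℕ) :
    polyD K X (MvPolynomial.X z) = MvPolynomial.X (z.1, z.2 + 1) :=
  MvPolynomial.mkDerivation_X K _ z

theorem polyD_mem_polyPart {a b : ℤ} (hb : a + 1 = b) {p : MvPolynomial (X × ℕ) K}
    (hp : p ∈ polyPart K X a) : polyD K X p ∈ polyPart K X b := by
  subst hb
  induction hp using Submodule.span_induction with
  | zero => rw [map_zero]; exact zero_mem _
  | add p q _ _ hp hq => rw [map_add]; exact add_mem hp hq
  | smul r p _ hp => rw [Derivation.map_smul]; exact Submodule.smul_mem _ r hp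
  | mem p hp =>
    obtain ⟨m, rfl, rfl⟩ := hp
    induction m using Multiset.induction_on with
    | empty => simp
    | cons z m ih =>
      rw [Multiset.map_cons, Multiset.prod_cons, Derivation.leibniz, polyD_X, polyWeight_cons]
      exact add_mem (mul_mem_polyPart (by ring) (X_mem_polyPart z) ih)
        (mul_mem_polyPart (by push_cast; ring) (prod_X_mem_polyPart m)
          (X_mem_polyPart (z.1, z.2 + 1)))

theorem toPoly_mem_polyPart {a : ℤ} {P : ℕ → Prop} {u : DerPerm K X} (hu : u ∈ part K X a P) :
    toPoly K X u ∈ polyPart K X a := by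
  induction hu using Submodule.span_induction with
  | zero => rw [map_zero]; exact zero_mem _
  | add u v _ _ hu hv => rw [map_add]; exact add_mem hu hv
  | smul r u _ hu => rw [LinearMap.map_smul_of_tower]; exact Submodule.smul_mem _ r hu
  | mem u hu =>
    obtain ⟨m, y, rfl, _, rfl⟩ := hu
    rw [map_smul, toPoly_letter, smul_eq_mul]
    exact mul_mem_polyPart rfl (prod_X_mem_polyPart m) (X_mem_polyPart y)

theorem d_mem_part {a b : ℤ} (hb : a + 1 = b) {P : ℕ → Prop} (hP : ∀ k, P k → P (k + 1))
    {u : DerPerm K X} (hu : u ∈ part K X a P) : d K X u ∈ part K X b P := by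
  induction hu using Submodule.span_induction with
  | zero => rw [map_zero]; exact zero_mem _
  | add u v _ _ hu hv => rw [map_add]; exact add_mem hu hv
  | smul r u _ hu => rw [map_smul]; exact Submodule.smul_mem _ r hu
  | mem u hu =>
    obtain ⟨m, y, hm, hy, rfl⟩ := hu
    rw [d_smul_letter]
    exact add_mem
      (smul_mem_part (by omega) (polyD_mem_polyPart rfl (prod_X_mem_polyPart m))
        (letter_mem_part y hy))
      (smul_mem_part (by push_cast; omega) (prod_X_mem_polyPart m)
        (letter_mem_part (y.1, y.2 + 1) (hP _ hy)))

theorem part_mono {a : ℤ} {P Q : ℕ → Prop} (h : ∀ k, P k → Q k) : part K X a P ≤ part K X a Q := by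
  refine Submodule.span_mono ?_
  rintro _ ⟨m, y, hw, hy, rfl⟩
  exact ⟨m, y, hw, h _ hy, rfl⟩

theorem part_sup (a : ℤ) (P : ℕ → Prop) :
    part K X a P ⊔ part K X a (fun k => ¬ P k) = part K X a (fun _ => True) := by
  refine le_antisymm (sup_le (part_mono fun _ _ => trivial) (part_mono fun _ _ => trivial))
    (Submodule.span_le.2 ?_)
  rintro _ ⟨m, y, hw, -, rfl⟩
  by_cases hy : P y.2
  · exact Submodule.mem_sup_left (Submodule.subset_span ⟨m, y, hw, hy, rfl⟩)
  · exact Submodule.mem_sup_right (Submodule.subset_span ⟨m, y, hw, hy, rfl⟩)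

theorem disjoint_part (a : ℤ) (P : ℕ → Prop) :
    Disjoint (part K X a P) (part K X a (fun k => ¬ P k)) := by
  -- the component of an element of `part K X a Q` at a last letter that violates `Q` vanishes
  have key : ∀ Q : ℕ → Prop, ∀ u ∈ part K X a Q, ∀ y : X × ℕ, ¬ Q y.2 →
      Finsupp.lapply (R := K) (M := MvPolynomial (X × ℕ) K) y u = 0 := by
    intro Q u hu y hy
    refine (Submodule.span_le.2 ?_ :
      part K X a Q ≤ LinearMap.ker (Finsupp.lapply (R := K) (M := MvPolynomial (X × ℕ) K) y)) hu
    rintro _ ⟨m, z, -, hz, rfl⟩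
    rw [← single_eq_smul]
    refine Finsupp.single_eq_of_ne ?_
    rintro rfl
    exact hy hz
  refine Submodule.disjoint_def.2 fun u h₁ h₂ => ?_
  refine Finsupp.ext (M := MvPolynomial (X × ℕ) K) fun y => ?_
  by_cases hy : P y.2
  · exact key _ u h₂ y (not_not.2 hy)
  · exact key _ u h₁ y hy

/-! ### Factorization of commutative monomials -/

/-- A monomial of weight at most `-n` is divisible by `n` letters of order zero. -/
theorem exists_zero_letters (n : ℕ) (m : Multiset (X × ℕ)) (hm : polyWeight m ≤ -n) :
    ∃ (Y : Multiset X) (r : Multiset (X × ℕ)), Multiset.card Y = n ∧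
      m = Y.map (fun y => (y, 0)) + r ∧ polyWeight r = polyWeight m + n := by
  induction n with
  | zero => exact ⟨0, m, rfl, by simp, by simp⟩
  | succ n ih =>
    obtain ⟨Y, r, hY, rfl, hr⟩ := ih (by push_cast at hm; omega)
    obtain ⟨z, hz, hz0⟩ : ∃ z ∈ r, z.2 = 0 := by
      by_contra! hc
      have : 0 ≤ polyWeight r := by
        refine Multiset.sum_nonneg fun a ha => ?_
        obtain ⟨z, hz, rfl⟩ := Multiset.mem_map.1 ha
        have := hc z hz
        omega
      push_cast at hm
      omega
    obtain ⟨r, rfl⟩ := Multiset.exists_cons_of_mem hz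
    obtain ⟨y, k⟩ := z
    obtain rfl : k = 0 := hz0
    refine ⟨y ::ₘ Y, r, by simp [hY], ?_, ?_⟩
    · rw [Multiset.map_cons, Multiset.add_cons, Multiset.cons_add]
    · rw [polyWeight_cons] at hr
      push_cast at hr ⊢
      linarith

/-- The polynomial `x^(k+1) y₁ ⋯ yₖ` of weight zero. -/
noncomputable def block (x : X) (Y : Multiset X) : MvPolynomial (X × ℕ) K :=
  MvPolynomial.X (x, Multiset.card Y + 1) * (Y.map fun y => MvPolynomial.X (y, 0)).prod

/-- Every monomial of weight zero is a product of blocks. -/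
theorem prod_X_mem_of_block_mem (S : Subalgebra K (MvPolynomial (X × ℕ) K))
    (hS : ∀ x Y, block x Y ∈ S) (m : Multiset (X × ℕ)) (hm : polyWeight m = 0) :
    (m.map (MvPolynomial.X (R := K))).prod ∈ S := by
  induction hn : Multiset.card m using Nat.strong_induction_on generalizing m with
  | _ n ih =>
    rcases Multiset.empty_or_exists_mem m with rfl | ⟨z₀, hz₀⟩
    · simp
    obtain ⟨z, hz, hz0⟩ : ∃ z ∈ m, z.2 ≠ 0 := by
      by_contra! hc
      obtain ⟨r, rfl⟩ := Multiset.exists_cons_of_mem hz₀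
      have : polyWeight r ≤ 0 := by
        rw [← neg_nonneg, polyWeight, ← Multiset.sum_map_neg]
        refine Multiset.sum_nonneg fun a ha => ?_
        obtain ⟨z, hz, rfl⟩ := Multiset.mem_map.1 ha
        have := hc z (Multiset.mem_cons_of_mem hz)
        omega
      have h0 := hc z₀ (Multiset.mem_cons_self _ _)
      rw [polyWeight_cons, h0] at hm
      push_cast at hm
      omega
    obtain ⟨m, rfl⟩ := Multiset.exists_cons_of_mem hz
    obtain ⟨x, k⟩ := z
    obtain ⟨k, rfl⟩ := Nat.exists_eq_succ_of_ne_zero hz0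
    rw [polyWeight_cons] at hm
    push_cast at hm
    obtain ⟨Y, r, rfl, rfl, hr⟩ := exists_zero_letters k m (by omega)
    have := mul_mem (hS x Y) (ih (Multiset.card r) (by simp at hn; omega) r (by omega) rfl)
    rw [block] at this
    simpa [Multiset.map_map, Function.comp_def, mul_assoc] using this

/-! ### The subalgebras generated by `X` under `≻` and under `≺` -/

theorem of_mem_succAlg (x : X) : of K x ∈ succAlg K X := subset_opClosure ⟨x, rfl⟩

theorem of_mem_precAlg (x : X) : of K x ∈ precAlg K X := subset_opClosure ⟨x, rfl⟩

variable (K X) in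
/-- The polynomials that map the algebra `DerPerm_≻⟨X⟩` into itself. -/
noncomputable def succStabilizer : Subalgebra K (MvPolynomial (X × ℕ) K) where
  carrier := {p | ∀ u ∈ succAlg K X, p • u ∈ succAlg K X}
  mul_mem' hp hq u hu := by
    rw [mul_smul]
    exact hp _ (hq _ hu)
  add_mem' hp hq u hu := by
    rw [add_smul]
    exact add_mem (hp _ hu) (hq _ hu)
  algebraMap_mem' r u hu := by
    rw [algebraMap_smul]
    exact Submodule.smul_mem _ r hu

theorem toPoly_d_mem_succStabilizer {u : DerPerm K X} (hu : u ∈ succAlg K X) :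
    toPoly K X (d K X u) ∈ succStabilizer K X := fun _ hv => op_mem_opClosure hu hv

/-- The block `x^(k+2) y y₁ ⋯ yₖ` is obtained from the derivative of `(x^(k+1) y₁ ⋯ yₖ) y`. -/
theorem block_mem_succStabilizer (x : X) (Y : Multiset X) : block x Y ∈ succStabilizer K X := by
  classical
  induction hn : Multiset.card Y generalizing x Y with
  | zero =>
    rw [Multiset.card_eq_zero.1 hn]
    have := toPoly_d_mem_succStabilizer (of_mem_succAlg (K := K) x)
    rw [of, d_letter, toPoly_letter] at this
    simpa [block] using this
  | succ n ih =>
    obtain ⟨y, hy⟩ := Multiset.card_pos_iff_exists_mem.1 (by omega : 0 < Multiset.card Y)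
    obtain ⟨W, rfl⟩ := Multiset.exists_cons_of_mem hy
    have hW : Multiset.card W = n := by simpa using hn
    have hb : ∀ x : X, MvPolynomial.X (x, 1) ∈ succStabilizer K X := fun x => by
      have := toPoly_d_mem_succStabilizer (of_mem_succAlg (K := K) x)
      rwa [of, d_letter, toPoly_letter] at this
    have h1 := toPoly_d_mem_succStabilizer (ih x W hW _ (of_mem_succAlg y))
    have h2 : (W.map fun w => block x (y ::ₘ W.erase w) * MvPolynomial.X (w, 1)).sum ∈
        succStabilizer K X := by
      refine multiset_sum_mem _ fun s hs => ?_
      obtain ⟨w, hw, rfl⟩ := Multiset.mem_map.1 hs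
      exact mul_mem (ih _ _ (by rw [Multiset.card_cons, Multiset.card_erase_add_one hw, hW])) (hb w)
    have h3 := mul_mem (ih x W hW) (hb y)
    have h4 : (W.map fun w => block x (y ::ₘ W.erase w) * MvPolynomial.X (w, 1)) =
        W.map fun w => (MvPolynomial.X (x, n + 1) * MvPolynomial.X (y, 0) :
          MvPolynomial (X × ℕ) K) *
          (((W.erase w).map fun y => MvPolynomial.X (y, 0)).prod *
            polyD K X (MvPolynomial.X (w, 0))) := by
      refine Multiset.map_congr rfl fun w hw => ?_
      rw [block, Multiset.card_cons, Multiset.card_erase_add_one hw, hW, Multiset.map_cons,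
        Multiset.prod_cons, polyD_X]
      ring
    convert sub_mem (sub_mem h1 h2) h3 using 1
    rw [h4, Multiset.sum_map_mul_left, toPoly_d, map_smul, of, toPoly_letter, smul_eq_mul,
      Derivation.leibniz, block, block, Derivation.leibniz, Derivation.map_multiset_prod,
      polyD_X, polyD_X, hW, Multiset.card_cons, hW, Multiset.map_cons, Multiset.prod_cons]
    simp only [smul_eq_mul]
    ring

theorem succAlg_eq : succAlg K X = part K X (-1) (· = 0) := by
  apply le_antisymm
  · refine opClosure_le ?_ fun a ha b hb => ?_
    · rintro _ ⟨x, rfl⟩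
      exact letter_mem_part (P := (· = 0)) (x, 0) rfl
    · have h := polyD_mem_polyPart (neg_add_cancel 1) (toPoly_mem_polyPart ha)
      rw [← toPoly_d] at h
      change toPoly K X (d K X a) • b ∈ _
      exact smul_mem_part (zero_add _) h hb
  · refine Submodule.span_le.2 ?_
    rintro _ ⟨m, ⟨x, k⟩, hw, rfl, rfl⟩
    exact prod_X_mem_of_block_mem _ block_mem_succStabilizer m (by push_cast at hw; omega) _
      (of_mem_succAlg x)

/-- The commutative images of `DerPerm_≻⟨X⟩` and `DerPerm_≺⟨X⟩` coincide, since `≻` and `≺` induce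
opposite operations on polynomials. -/
theorem polyPart_le_map_precAlg :
    polyPart K X (-1) ≤ (precAlg K X).map ((toPoly K X).restrictScalars K) := by
  have h : succAlg K X ≤ ((precAlg K X).map ((toPoly K X).restrictScalars K)).comap
      ((toPoly K X).restrictScalars K) := by
    refine opClosure_le ?_ ?_
    · rintro _ ⟨x, rfl⟩
      exact ⟨of K x, of_mem_precAlg x, rfl⟩
    · rintro a ⟨a', ha, hea⟩ b ⟨b', hb, heb⟩
      refine ⟨prec K X b' a', op_mem_opClosure hb ha, ?_⟩
      change toPoly K X (b' * d K X a') = toPoly K X (d K X a * b)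
      change toPoly K X a' = toPoly K X a at hea
      change toPoly K X b' = toPoly K X b at heb
      rw [toPoly_mul, toPoly_mul, toPoly_d, toPoly_d, hea, heb, mul_comm]
  refine Submodule.span_le.2 ?_
  rintro _ ⟨m, hm, rfl⟩
  obtain ⟨Y, r, hY, rfl, hr⟩ := exists_zero_letters 1 m (by rw [hm]; rfl)
  obtain ⟨y, rfl⟩ := Multiset.card_eq_one.1 hY
  have hmem : (r.map (MvPolynomial.X (R := K))).prod • of K y ∈ succAlg K X := by
    rw [succAlg_eq]
    exact Submodule.subset_span ⟨r, (y, 0), by push_cast at hr ⊢; omega, rfl, rfl⟩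
  have := h hmem
  rw [Submodule.mem_comap, LinearMap.restrictScalars_apply, map_smul, of, toPoly_letter,
    smul_eq_mul, mul_comm] at this
  simpa using this

theorem smul_d_mem_opSquare {p : MvPolynomial (X × ℕ) K} (hp : p ∈ polyPart K X (-1))
    {v : DerPerm K X} (hv : v ∈ precAlg K X) :
    p • d K X v ∈ opSquare (prec K X) (precAlg K X) := by
  obtain ⟨u, hu, rfl⟩ := polyPart_le_map_precAlg hp
  exact Submodule.subset_span ⟨u, hu, v, hv, rfl⟩

/-- Induction on the order of the last letter:
`y q x^(k+1) = y (q x^(k))' - (y q') x^(k)` for a letter `y` of order zero. -/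
theorem smul_letter_mem_opSquare (x : X) (k : ℕ) {p : MvPolynomial (X × ℕ) K}
    (hp : p ∈ polyPart K X (-(k + 1 : ℕ))) :
    p • letter K (x, k + 1) ∈ opSquare (prec K X) (precAlg K X) := by
  induction k generalizing p with
  | zero =>
    have := smul_d_mem_opSquare hp (of_mem_precAlg x)
    rwa [of, d_letter] at this
  | succ k ih =>
    refine (Submodule.span_le.2 ?_ : polyPart K X (-(k + 1 + 1 : ℕ)) ≤
      (opSquare (prec K X) (precAlg K X)).comap
        ((LinearMap.toSpanSingleton _ _ (letter K (x, k + 1 + 1))).restrictScalars K)) hp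
    rintro _ ⟨m, hm, rfl⟩
    obtain ⟨Y, r, hY, rfl, hr⟩ := exists_zero_letters 1 m (by rw [hm]; push_cast; omega)
    obtain ⟨y, rfl⟩ := Multiset.card_eq_one.1 hY
    have hy : MvPolynomial.X (y, 0) ∈ polyPart K X (-1) := X_mem_polyPart (y, 0)
    have hq := prod_X_mem_polyPart (K := K) r
    rw [hr, hm] at hq
    have hq : (r.map MvPolynomial.X).prod ∈ polyPart K X (-(k + 1 : ℕ)) := by
      convert hq using 1
      push_cast
      ring_nf
    have h1 := smul_d_mem_opSquare hy (opSquare_le_opClosure (ih hq))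
    have h2 := ih (p := MvPolynomial.X (y, 0) * polyD K X (r.map MvPolynomial.X).prod) (by
      exact mul_mem_polyPart (by push_cast; ring) hy (polyD_mem_polyPart rfl hq))
    have h3 := sub_mem h1 h2
    rw [d_smul_letter, smul_add, ← mul_smul, add_sub_cancel_left, ← mul_smul] at h3
    simpa using h3

theorem part_le_opSquare : part K X (-1) (· ≠ 0) ≤ opSquare (prec K X) (precAlg K X) := by
  refine Submodule.span_le.2 ?_
  rintro _ ⟨m, ⟨x, k⟩, hw, hk, rfl⟩
  obtain ⟨k, rfl⟩ := Nat.exists_eq_succ_of_ne_zero hk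
  refine smul_letter_mem_opSquare x k ?_
  convert prod_X_mem_polyPart (K := K) m using 1
  push_cast at hw ⊢
  rw [show polyWeight m = -((k : ℤ) + 1) by omega]

theorem prec_mem_part {a b : DerPerm K X}
    (ha : a ∈ Submodule.span K (Set.range (of K : X → DerPerm K X)) ⊔ part K X (-1) (· ≠ 0))
    (hb : b ∈ Submodule.span K (Set.range (of K : X → DerPerm K X)) ⊔ part K X (-1) (· ≠ 0)) :
    prec K X a b ∈ part K X (-1) (· ≠ 0) := by
  have h1 : Submodule.span K (Set.range (of K : X → DerPerm K X)) ⊔ part K X (-1) (· ≠ 0) ≤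
      part K X (-1) (fun _ => True) := by
    refine sup_le (Submodule.span_le.2 ?_) (part_mono fun _ _ => trivial)
    rintro _ ⟨x, rfl⟩
    exact letter_mem_part (P := fun _ => True) (x, 0) trivial
  have h2 : Submodule.span K (Set.range (of K : X → DerPerm K X)) ⊔ part K X (-1) (· ≠ 0) ≤
      (part K X 0 (· ≠ 0)).comap (d K X) := by
    refine sup_le (Submodule.span_le.2 ?_) fun u hu => ?_
    · rintro _ ⟨x, rfl⟩
      rw [SetLike.mem_coe, Submodule.mem_comap, of, d_letter]
      exact letter_mem_part (P := (· ≠ 0)) (x, 1) one_ne_zero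
    · rw [Submodule.mem_comap]
      exact d_mem_part (neg_add_cancel 1) (fun k _ => Nat.succ_ne_zero k) hu
  change toPoly K X a • d K X b ∈ _
  exact smul_mem_part (add_zero _) (toPoly_mem_polyPart (h1 ha)) (h2 hb)

theorem precAlg_eq : precAlg K X =
    Submodule.span K (Set.range (of K : X → DerPerm K X)) ⊔ part K X (-1) (· ≠ 0) := by
  apply le_antisymm
  · exact opClosure_le (Submodule.subset_span.trans (SetLike.coe_subset_coe.2 le_sup_left))
      fun a ha b hb => Submodule.mem_sup_right (prec_mem_part ha hb)
  · exact sup_le (Submodule.span_le.2 subset_opClosure)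
      (part_le_opSquare.trans opSquare_le_opClosure)

theorem opSquare_precAlg_eq :
    opSquare (prec K X) (precAlg K X) = part K X (-1) (· ≠ 0) := by
  refine le_antisymm (Submodule.span_le.2 ?_) part_le_opSquare
  rintro _ ⟨a, ha, b, hb, rfl⟩
  rw [precAlg_eq] at ha hb
  exact prec_mem_part ha hb

theorem span_of_le_succAlg :
    Submodule.span K (Set.range (of K : X → DerPerm K X)) ≤ succAlg K X :=
  Submodule.span_le.2 subset_opClosure

theorem succAlg_sup_opSquare :
    succAlg K X ⊔ opSquare (prec K X) (precAlg K X) = weightNegOne K X := by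
  rw [succAlg_eq, opSquare_precAlg_eq, weightNegOne_eq]
  exact part_sup (-1) (· = 0)

theorem disjoint_succAlg_opSquare :
    Disjoint (succAlg K X) (opSquare (prec K X) (precAlg K X)) := by
  rw [succAlg_eq, opSquare_precAlg_eq]
  exact disjoint_part (-1) (· = 0)

theorem succAlg_inf_precAlg :
    succAlg K X ⊓ precAlg K X = Submodule.span K (Set.range (of K : X → DerPerm K X)) := by
  rw [precAlg_eq, ← opSquare_precAlg_eq, inf_comm, sup_inf_assoc_of_le _ span_of_le_succAlg,
    disjoint_succAlg_opSquare.symm.eq_bot, sup_bot_eq]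

end DerPerm

/-! ### The free Novikov dialgebra inside `DerPerm⟨X⟩` -/

namespace DiNov

open DerPerm

variable (K X : Type*) [Field K]

theorem map_span_of :
    (Submodule.span K (Set.range (of K : X → DiNov K X))).map (toDerPerm K X) =
      Submodule.span K (Set.range (DerPerm.of K : X → DerPerm K X)) := by
  rw [Submodule.map_span, ← Set.range_comp]
  congr 2
  exact funext toDerPerm_of

theorem map_succAlg : (succAlg K X).map (toDerPerm K X) = DerPerm.succAlg K X := by
  refine (map_opClosure (op' := DerPerm.succ K X) (toDerPerm K X)
    fun a b => toDerPerm_dv b a).trans ?_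
  rw [← Set.range_comp, DerPerm.succAlg]
  congr 2
  exact funext toDerPerm_of

theorem map_precAlg : (precAlg K X).map (toDerPerm K X) = DerPerm.precAlg K X := by
  refine (map_opClosure (op' := DerPerm.prec K X) (toDerPerm K X) toDerPerm_vd).trans ?_
  rw [← Set.range_comp, DerPerm.precAlg]
  congr 2
  exact funext toDerPerm_of

theorem map_opSquare_precAlg :
    (opSquare (prec K X) (precAlg K X)).map (toDerPerm K X) =
      opSquare (DerPerm.prec K X) (DerPerm.precAlg K X) := by
  rw [← map_precAlg]
  exact map_opSquare (toDerPerm K X) toDerPerm_vd _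

theorem range_toDerPerm : LinearMap.range (toDerPerm K X) = weightNegOne K X := by
  apply le_antisymm
  · rw [← Submodule.map_top, Submodule.map_le_iff_le_comap, weightNegOne_eq]
    refine (eq_top_of_closed _ (fun x => ?_) (fun a ha b hb => ?_) fun a ha b hb => ?_).ge <;>
      rw [Submodule.mem_comap] at *
    · rw [toDerPerm_of]
      exact letter_mem_part (P := fun _ => True) (x, 0) trivial
    · rw [toDerPerm_vd, mul_def]
      exact smul_mem_part (add_zero _) (toPoly_mem_polyPart ha)
        (d_mem_part (neg_add_cancel 1) (fun _ _ => trivial) hb)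
    · rw [toDerPerm_dv, mul_def]
      exact smul_mem_part (zero_add _)
        (toPoly_mem_polyPart (d_mem_part (neg_add_cancel 1) (fun _ _ => trivial) hb)) ha
  · rw [← succAlg_sup_opSquare, ← map_succAlg, ← map_opSquare_precAlg, ← Submodule.map_sup]
    exact LinearMap.map_le_range

theorem isCompl_succAlg_opSquare :
    IsCompl (succAlg K X) (opSquare (prec K X) (precAlg K X)) := by
  have hinj := Submodule.map_injective_of_injective (toDerPerm_injective K X)
  constructor
  · rw [disjoint_iff]
    apply hinj
    rw [Submodule.map_inf _ (toDerPerm_injective K X), map_succAlg, map_opSquare_precAlg,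
      disjoint_succAlg_opSquare.eq_bot, Submodule.map_bot]
  · rw [codisjoint_iff]
    apply hinj
    rw [Submodule.map_sup, map_succAlg, map_opSquare_precAlg, succAlg_sup_opSquare,
      Submodule.map_top, range_toDerPerm]

theorem succAlg_inf_precAlg :
    succAlg K X ⊓ precAlg K X = Submodule.span K (Set.range (of K : X → DiNov K X)) := by
  apply Submodule.map_injective_of_injective (toDerPerm_injective K X)
  rw [Submodule.map_inf _ (toDerPerm_injective K X), map_succAlg, map_precAlg, map_span_of,
    DerPerm.succAlg_inf_precAlg]

end DiNov

theorem mainTheorem5 (K X : Type*) [Field K] :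
    -- `di-Nov⟨X⟩` is embedded in `DerPerm⟨X⟩` as the span of the monomials of weight `-1`
    (Function.Injective (DiNov.toDerPerm K X) ∧
      LinearMap.range (DiNov.toDerPerm K X) = DerPerm.weightNegOne K X) ∧
    -- the subalgebras generated by `X` under `≻` and `≺` correspond to `DerPerm_≻⟨X⟩`
    -- and `DerPerm_≺⟨X⟩`
    ((DiNov.succAlg K X).map (DiNov.toDerPerm K X) = DerPerm.succAlg K X ∧
      (DiNov.precAlg K X).map (DiNov.toDerPerm K X) = DerPerm.precAlg K X) ∧
    -- `di-Nov⟨X⟩` is their sum, and they have in common only the span of `X`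
    (DiNov.succAlg K X ⊔ DiNov.precAlg K X = ⊤ ∧
      DiNov.succAlg K X ⊓ DiNov.precAlg K X =
        Submodule.span K (Set.range (DiNov.of K : X → DiNov K X))) ∧
    -- with the generators counted once, the sum is direct
    IsCompl (DiNov.succAlg K X) (opSquare (DiNov.prec K X) (DiNov.precAlg K X)) ∧
    (∀ a : DiNov K X, ∃! p : DiNov K X × DiNov K X, p.1 ∈ DiNov.succAlg K X ∧
      p.2 ∈ opSquare (DiNov.prec K X) (DiNov.precAlg K X) ∧ a = p.1 + p.2) ∧
    -- the decomposition is that of the monomials of weight `-1` by the last letter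
    (DerPerm.succAlg K X = DerPerm.weightNegOneZero K X ∧
      opSquare (DerPerm.prec K X) (DerPerm.precAlg K X) = DerPerm.weightNegOnePos K X ∧
      DerPerm.precAlg K X =
        Submodule.span K (Set.range (DerPerm.of K : X → DerPerm K X)) ⊔
          DerPerm.weightNegOnePos K X) := by
  have hc := DiNov.isCompl_succAlg_opSquare K X
  refine ⟨⟨DiNov.toDerPerm_injective K X, DiNov.range_toDerPerm K X⟩,
    ⟨DiNov.map_succAlg K X, DiNov.map_precAlg K X⟩, ⟨?_, DiNov.succAlg_inf_precAlg K X⟩, hc, ?_,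
    ?_, ?_, ?_⟩
  · exact top_le_iff.1 (hc.sup_eq_top.ge.trans (sup_le_sup_left opSquare_le_opClosure _))
  · intro a
    obtain ⟨b, hb, c, hc', rfl⟩ :=
      Submodule.mem_sup.1 (hc.sup_eq_top ▸ Submodule.mem_top : a ∈ _ ⊔ _)
    refine ⟨(b, c), ⟨hb, hc', rfl⟩, ?_⟩
    rintro ⟨b', c'⟩ ⟨hb', hc'', he⟩
    dsimp only at hb' hc'' he
    -- the difference of two decompositions lies in both summands
    have hsub : b' - b = c - c' := by
      rw [sub_eq_sub_iff_add_eq_add, ← he, add_comm]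
    have h0 := Submodule.disjoint_def.1 hc.disjoint (b' - b) (sub_mem hb' hb)
      (hsub ▸ sub_mem hc' hc'')
    rw [Prod.mk.injEq, ← sub_eq_zero, ← sub_eq_zero (a := c'), ← neg_sub c, ← hsub, h0, neg_zero]
    exact ⟨rfl, rfl⟩
  · rw [DerPerm.succAlg_eq, DerPerm.weightNegOneZero_eq]
  · rw [DerPerm.opSquare_precAlg_eq, DerPerm.weightNegOnePos_eq]
  · rw [DerPerm.precAlg_eq, DerPerm.weightNegOnePos_eq]
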